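/- Let $\Sigma \subset \mathbb{R}^d$, $d \ge 2$, be a bounded, smooth hypersurface without boundary, that is, a compact embedded $(d-1)$-manifold without boundary (not necessarily connected; class $C^2$ suffices). The medial axis $M$ of $\Sigma$ is the closure of the set of centers of all open balls that are disjoint from $\Sigma$ and whose boundary meets $\Sigma$ in more than one point, and $\mathrm{lfs}(p) = \min_{m \in M} |pm|$ is the local feature size at $p$. A nonzero vector $n$ normal to $\Sigma$ at $p$ is outward-directed if, with $C$ the connected component of $\Sigma$ containing $p$, for all sufficiently small $t>0$ the point $p + tn$ lies in an unbounded component of $\mathbb{R}^d \setminus C$ and $p - tn$ lies in a bounded component of $\mathbb{R}^d \setminus C$. Let $p, q \in \Sigma$, let $n_p$ and $n_q$ be outward-directed vectors normal to $\Sigma$ at $p$ and $q$, let $\delta = |pq| / \mathrm{lfs}(p)$, and let $\delta_N$ be the distance from $q$ to the tangent space $T_p\Sigma$ (the hyperplane through $p$ tangent to $\Sigma$) divided by $\mathrm{lfs}(p)$. If $\delta < \sqrt{4\sqrt{5} - 8} \doteq 0.9717$, then $$\angle(n_p, n_q) \le \eta_1(\delta) := \arccos\left(1 - \frac{\delta^2}{2\sqrt{1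 - \delta^2}}\right)$$ and moreover $$\angle(n_p, n_q) \le \arccos\left(1 - \frac{\delta^2 - \delta^4/2 - 2\delta_N^2}{\sqrt{(1 - \delta^2)\left((2 - \delta^2)^2 - 4\delta_N^2\right)}}\right),$$ where the right-hand side of the second bound is strictly smaller than $\eta_1(\delta)$ if $\delta_N \ne 0$. As $\delta \to 0^+$, $$\eta_1(\delta) = \delta + \tfrac{7}{24}\delta^3 + \tfrac{123}{640}\delta^5 + \tfrac{1083}{7168}\delta^7 + O(\delta^9).$$ -/

import Mathlib

open Set Metric Filter Topology Asymptotics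

/-- `S ⊆ ℝ^d` is a compact hypersurface without boundary, of class `C²`: a compact set that near
each of its points is the zero set of a `C²` function whose derivative at the point is not zero. -/
structure IsClosedHypersurface {d : ℕ} (S : Set (EuclideanSpace ℝ (Fin d))) : Prop where
  isCompact : IsCompact S
  locally_zero_set : ∀ p ∈ S, ∃ (U : Set (EuclideanSpace ℝ (Fin d)))
    (f : EuclideanSpace ℝ (Fin d) → ℝ), IsOpen U ∧ p ∈ U ∧ ContDiffOn ℝ 2 f U ∧
      fderiv ℝ f p ≠ 0 ∧ S ∩ U = {x ∈ U | f x = 0}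

/-- The medial axis of `S`: the closure of the set of the centers of those open balls that are
disjoint from `S` and whose boundary meets `S` in more than one point. -/
def medialAxis {d : ℕ} (S : Set (EuclideanSpace ℝ (Fin d))) : Set (EuclideanSpace ℝ (Fin d)) :=
  closure {w | ∃ r : ℝ, Disjoint (ball w r) S ∧ (sphere w r ∩ S).Nontrivial}

/-- The local feature size: the distance to the medial axis. -/
noncomputable def lfs {d : ℕ} (S : Set (EuclideanSpace ℝ (Fin d)))
    (p : EuclideanSpace ℝ (Fin d)) : ℝ :=
  infDist p (medialAxis S)

/-- The tangent space of `S` at `p`, as a flat through `p`. The set of tangent directions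
`tangentConeAt ℝ S p` is Mathlib's; at a point of a hypersurface it is a linear hyperplane. -/
def tangentFlat {d : ℕ} (S : Set (EuclideanSpace ℝ (Fin d))) (p : EuclideanSpace ℝ (Fin d)) :
    Set (EuclideanSpace ℝ (Fin d)) :=
  (fun v => p + v) '' tangentConeAt ℝ S p

/-- `n` is normal to `S` at `p`: it is orthogonal to all tangent directions. -/
def IsNormalAt {d : ℕ} (S : Set (EuclideanSpace ℝ (Fin d))) (p n : EuclideanSpace ℝ (Fin d)) :
    Prop :=
  ∀ v ∈ tangentConeAt ℝ S p, inner ℝ n v = 0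

/-- The outside of `C`: the union of the unbounded components of the complement. -/
def outside {d : ℕ} (C : Set (EuclideanSpace ℝ (Fin d))) : Set (EuclideanSpace ℝ (Fin d)) :=
  {x | x ∉ C ∧ ¬ Bornology.IsBounded (connectedComponentIn Cᶜ x)}

/-- The inside of `C`: the union of the bounded components of the complement. -/
def inside {d : ℕ} (C : Set (EuclideanSpace ℝ (Fin d))) : Set (EuclideanSpace ℝ (Fin d)) :=
  {x | x ∉ C ∧ Bornology.IsBounded (connectedComponentIn Cᶜ x)}

/-- `n` is an outward-directed normal vector of `S` at `p` (not necessarily of unit length): it is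
nonzero, normal to `S`, and points at `p` from the inside to the outside of the connected component
of `S` that contains `p`. -/
structure IsOutwardNormal {d : ℕ} (S : Set (EuclideanSpace ℝ (Fin d)))
    (p n : EuclideanSpace ℝ (Fin d)) : Prop where
  ne_zero : n ≠ 0
  isNormalAt : IsNormalAt S p n
  outward : ∀ᶠ t : ℝ in 𝓝[>] 0,
    p + t • n ∈ outside (connectedComponentIn S p) ∧
    p - t • n ∈ inside (connectedComponentIn S p)

/-- The relative distance `δ = |pq| / lfs(p)`. -/
noncomputable def relDist {d : ℕ} (S : Set (EuclideanSpace ℝ (Fin d)))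
    (p q : EuclideanSpace ℝ (Fin d)) : ℝ :=
  dist p q / lfs S p

/-- The normal component `δ_N` of `δ`: the distance from `q` to the tangent space at `p`, divided
by `lfs(p)`. -/
noncomputable def relNormalDist {d : ℕ} (S : Set (EuclideanSpace ℝ (Fin d)))
    (p q : EuclideanSpace ℝ (Fin d)) : ℝ :=
  infDist q (tangentFlat S p) / lfs S p

/-- The bound `η₁(δ)`. -/
noncomputable def eta1 (δ : ℝ) : ℝ :=
  Real.arccos (1 - δ ^ 2 / (2 * √(1 - δ ^ 2)))

/-- The refined bound in terms of `δ` and `δ_N`. -/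
noncomputable def eta1N (δ δN : ℝ) : ℝ :=
  Real.arccos (1 - (δ ^ 2 - δ ^ 4 / 2 - 2 * δN ^ 2) /
    √((1 - δ ^ 2) * ((2 - δ ^ 2) ^ 2 - 4 * δN ^ 2)))

/-! Write L = lfs(p) and let c be the cosine of the angle between the normals. The medial axis keeps
distance L from p, and an empty ball touching Σ at a point can be grown while its center avoids the
medial axis (`infDist_ray`). Hence both balls of radius L tangent to Σ at p are empty. So are the
two balls tangent at q whose centers are the points where the normal line at q meets the sphere of
radius L about p. If their radii are sL and s'L, the power of the point q gives s s' = 1 - δ².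

The nearest-point map is continuous on the ball of radius L about p, so p and q lie in one component
C of Σ. Outer tangent balls lie outside C and inner ones inside, so the outer ball at q misses the
inner ball at p, and vice versa. Comparing the distances of the centers with the sums of the radii
gives (1 + s)² ≤ 2 + 2a + 2sc and (1 + s')² ≤ 2 - 2a + 2s'c, where aL is the signed normal component
of q - p and |a| = δ_N. Each is a lower bound on c that increases with s or s'. As s s' is fixed,
the worst case is where both bounds agree (`one_sub_div_sqrt_le`), which gives the refined bound; it
is weakest at a = 0, where it is η₁.

The C² hypothesis makes small tangent balls empty and keeps Σ off its medial axis. For the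
expansion, the cosines of η₁ and of its Taylor polynomial are compared to order δ¹⁰. -/

/-! ### Unique nearest points and the growth of empty tangent balls -/

section NearestPoint

variable {E : Type*} [NormedAddCommGroup E]

/-- At most one point of `S` realizes the distance from `w` to `S`. -/
def HasUniqueNearest (S : Set E) (w : E) : Prop :=
  (sphere w (infDist w S) ∩ S).Subsingleton

lemma HasUniqueNearest.eq {S : Set E} {w x y : E} (h : HasUniqueNearest S w) (hx : x ∈ S)
    (hy : y ∈ S) (hwx : infDist w S = dist w x) (hwy : infDist w S = dist w y) : x = y :=
  h ⟨by rw [mem_sphere, hwx, dist_comm], hx⟩ ⟨by rw [mem_sphere, hwy, dist_comm], hy⟩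

variable [InnerProductSpace ℝ E] [FiniteDimensional ℝ E]

/-- Nearest points depend continuously on the point where they are unique. -/
lemma HasUniqueNearest.eventually_dist_lt {S : Set E} (hS : IsClosed S) {c x : E}
    (hu : HasUniqueNearest S c) (hx : x ∈ S) (hcx : infDist c S = dist c x) {ε : ℝ} (hε : 0 < ε) :
    ∀ᶠ w in 𝓝 c, ∀ y ∈ S, infDist w S = dist w y → dist y x < ε := by
  have : ProperSpace E := FiniteDimensional.proper_real E
  set r := infDist c S with hr
  -- By compactness, points of `S` that stay `ε` away from `x` are farther from `c` than `r` by a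
  -- definite margin `2 * η`. A nearest point of `w` has distance below `r + 2 * η` from `c` once
  -- `dist w c < η`.
  let K := (closedBall c (r + 2) ∩ S) ∩ {y | ε ≤ dist y x}
  have hK : IsCompact K := ((isCompact_closedBall c (r + 2)).inter_right hS).inter_right
    (isClosed_le continuous_const (by fun_prop))
  have key : ∃ η > 0, η ≤ 1 ∧ ∀ y ∈ K, r + 2 * η < dist c y := by
    rcases K.eq_empty_or_nonempty with h | h
    · exact ⟨1, one_pos, le_rfl, by simp [h]⟩
    · obtain ⟨m, hm, hmin⟩ := hK.exists_isMinOn h (f := fun y => dist c y) (by fun_prop)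
      have h1 : r < dist c m := by
        refine lt_of_le_of_ne (infDist_le_dist_of_mem hm.1.2) fun h2 => ?_
        have := hu.eq hx hm.1.2 hcx h2
        have h3 : ε ≤ dist m x := hm.2
        rw [this, dist_self] at h3
        linarith
      refine ⟨min 1 ((dist c m - r) / 3), lt_min one_pos (by linarith), min_le_left _ _, ?_⟩
      intro y hy
      have h2 : dist c m ≤ dist c y := hmin hy
      have h3 := min_le_right 1 ((dist c m - r) / 3)
      linarith
  obtain ⟨η, hη, hη1, hK'⟩ := key
  filter_upwards [ball_mem_nhds c hη] with w hw y hy hwy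
  by_contra! hlt
  rw [mem_ball] at hw
  have h1 : infDist w S ≤ r + dist w c := infDist_le_infDist_add_dist
  have h2 : dist c y ≤ dist w c + dist w y := by
    simpa [dist_comm] using dist_triangle c w y
  have h3 := hK' y ⟨⟨by rw [mem_closedBall, dist_comm]; linarith, hy⟩, hlt⟩
  linarith

/-- Moving away from the nearest point, the distance grows at rate one, if the nearest point is
unique. -/
lemma HasUniqueNearest.eventually_infDist_ge {S : Set E} (hS : IsClosed S) {c x : E}
    (hu : HasUniqueNearest S c) (hx : x ∈ S) (hcx : infDist c S = dist c x) (hc : c ∉ S)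
    {κ : ℝ} (hκ : κ < 1) :
    ∀ᶠ h : ℝ in 𝓝[>] 0,
      infDist c S + κ * h ≤ infDist (c + h • ((dist c x)⁻¹ • (c - x))) S := by
  have : ProperSpace E := FiniteDimensional.proper_real E
  have hr : 0 < dist c x := dist_pos.2 fun h => hc (h ▸ hx)
  set u := (dist c x)⁻¹ • (c - x) with hudef
  have hux : inner ℝ u (c - x) = dist c x := by
    rw [hudef, real_inner_smul_left, real_inner_self_eq_norm_sq, ← dist_eq_norm]
    field_simp
  -- At `y = x` the inner product equals `‖c - y‖`, so `κ < 1` leaves room for nearby `y`.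
  -- Cauchy-Schwarz against `c - y` then bounds the new distance below.
  have h1 : ∀ᶠ y in 𝓝 x, 0 < inner ℝ u (c - y) - κ * ‖c - y‖ := by
    have hcont : ContinuousAt (fun y => inner ℝ u (c - y) - κ * ‖c - y‖) x := by fun_prop
    refine hcont.eventually_const_lt ?_
    change 0 < inner ℝ u (c - x) - κ * ‖c - x‖
    rw [hux, ← dist_eq_norm]
    nlinarith
  obtain ⟨ε, hε, hball⟩ := Metric.eventually_nhds_iff.1 h1
  have h2 := hu.eventually_dist_lt hS hx hcx hε
  have ht : Tendsto (fun h : ℝ => c + h • u) (𝓝[>] 0) (𝓝 c) := by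
    have : Tendsto (fun h : ℝ => c + h • u) (𝓝 0) (𝓝 (c + (0 : ℝ) • u)) :=
      (by fun_prop : Continuous fun h : ℝ => c + h • u).tendsto 0
    simp only [zero_smul, add_zero] at this
    exact this.mono_left nhdsWithin_le_nhds
  filter_upwards [ht.eventually h2, self_mem_nhdsWithin] with h hh (hpos : 0 < h)
  obtain ⟨y, hy, hwy⟩ := hS.exists_infDist_eq_dist ⟨x, hx⟩ (c + h • u)
  have h3 := hball (hh y hy hwy)
  have h4 : infDist c S ≤ dist c y := infDist_le_dist_of_mem hy
  have h5 : 0 < ‖c - y‖ := by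
    rw [← dist_eq_norm]; linarith
  have h6 := real_inner_le_norm (c + h • u - y) (c - y)
  have h7 : inner ℝ (c + h • u - y) (c - y) = ‖c - y‖ ^ 2 + h * inner ℝ u (c - y) := by
    rw [show c + h • u - y = (c - y) + h • u by abel, inner_add_left, real_inner_smul_left,
      real_inner_self_eq_norm_sq]
  rw [h7] at h6
  rw [hwy]
  rw [dist_eq_norm] at h4 ⊢
  have h8 : (‖c - y‖ + κ * h) * ‖c - y‖ ≤ ‖c + h • u - y‖ * ‖c - y‖ := by nlinarith
  have := le_of_mul_le_mul_right h8 h5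
  linarith

/-- If nearest points are unique in a ball about `c`, the point of the ball opposite to the nearest
point of `c` has the same nearest point. -/
lemma infDist_extend {S : Set E} (hS : IsClosed S) {c q : E} (hq : q ∈ S)
    (hcq : infDist c S = dist c q) {ε : ℝ} (hε : 0 < ε) (hεr : ε < dist c q)
    (hu : ∀ w ∈ ball c ε, HasUniqueNearest S w) :
    infDist (c + ε • ((dist c q)⁻¹ • (c - q))) S = dist c q + ε := by
  have : ProperSpace E := FiniteDimensional.proper_real E
  set r := dist c q with hr
  have hne : (closedBall c ε).Nonempty := ⟨c, mem_closedBall_self hε.le⟩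
  have hcomp := isCompact_closedBall c ε
  have hoff : ∀ w ∈ closedBall c ε, w ∉ S := by
    intro w hw hwS
    have h1 : infDist c S ≤ dist c w := infDist_le_dist_of_mem hwS
    rw [mem_closedBall, dist_comm] at hw
    linarith
  obtain ⟨w₀, hw₀, hmax₀⟩ := hcomp.exists_isMaxOn hne (f := fun w => infDist w S)
    (continuous_infDist_pt S).continuousOn
  -- A maximizer of the penalized distance must lie on the boundary sphere: at an interior point,
  -- moving away from the nearest point gains at rate `1 - η / 2`, more than the penalty `1 - η` can
  -- cost.
  have key : ∀ η : ℝ, 0 < η → η ≤ 1 → r + (1 - η) * ε ≤ infDist w₀ S := by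
    intro η hη hη1
    obtain ⟨w, hw, hmax⟩ := hcomp.exists_isMaxOn hne
      (f := fun w => infDist w S - (1 - η) * dist w c)
      ((continuous_infDist_pt S).sub (by fun_prop)).continuousOn
    have hmax₀w : infDist w S ≤ infDist w₀ S := hmax₀ hw
    have hwc : dist w c = ε := by
      refine le_antisymm hw (not_lt.1 fun hlt => ?_)
      obtain ⟨y, hy, hwy⟩ := hS.exists_infDist_eq_dist ⟨q, hq⟩ w
      have hwS := hoff w hw
      have h1 := (hu w hlt).eventually_infDist_ge hS hy hwy hwS (κ := 1 - η / 2) (by linarith)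
      have h2 : ∀ᶠ h : ℝ in 𝓝[>] 0, h < ε - dist w c :=
        nhdsWithin_le_nhds (eventually_lt_nhds (by linarith))
      obtain ⟨h, ⟨h3, h4⟩, h5 : 0 < h⟩ := ((h1.and h2).and self_mem_nhdsWithin).exists
      set u := (dist w y)⁻¹ • (w - y) with hudef
      have hun : ‖u‖ = 1 := by
        have : 0 < dist w y := dist_pos.2 fun h => hwS (h ▸ hy)
        rw [hudef, norm_smul, norm_inv, Real.norm_of_nonneg dist_nonneg, ← dist_eq_norm]
        field_simp
      have h6 : dist (w + h • u) c ≤ dist w c + h := by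
        have := dist_triangle (w + h • u) w c
        rw [dist_self_add_left, norm_smul, hun, mul_one, Real.norm_of_nonneg h5.le] at this
        linarith
      have h7 : infDist (w + h • u) S - (1 - η) * dist (w + h • u) c ≤
          infDist w S - (1 - η) * dist w c := hmax (show _ ∈ closedBall c ε by
            rw [mem_closedBall]; linarith)
      nlinarith
    have h1 : infDist c S - (1 - η) * dist c c ≤ infDist w S - (1 - η) * dist w c :=
      hmax (mem_closedBall_self hε.le)
    rw [dist_self, hwc] at h1
    linarith
  have hge : r + ε ≤ infDist w₀ S := by
    by_contra! hlt
    have h0 : infDist c S ≤ infDist w₀ S := hmax₀ (mem_closedBall_self hε.le)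
    -- This `η` makes the bound of `key` exceed `infDist w₀ S` by half of the supposed deficit.
    have h1 := key ((r + ε - infDist w₀ S) / (2 * ε)) (by apply div_pos <;> linarith)
      (by rw [div_le_one (by linarith)]; linarith)
    have h2 : (r + ε - infDist w₀ S) / (2 * ε) * ε = (r + ε - infDist w₀ S) / 2 := by
      field_simp
    linarith
  have h1 : infDist w₀ S ≤ dist w₀ q := infDist_le_dist_of_mem hq
  have h2 := dist_triangle w₀ c q
  have h3 : dist w₀ c ≤ ε := hw₀
  have h4 : dist w₀ c = ε := by linarith
  have h5 : ‖w₀ - c‖ = ε := by rw [← dist_eq_norm, h4]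
  have h6 : ‖c - q‖ = r := by rw [← dist_eq_norm]
  -- Equality in the triangle inequality forces `w₀` onto the ray from `q` through `c`.
  have h7 : ‖(w₀ - c) + (c - q)‖ = ‖w₀ - c‖ + ‖c - q‖ := by
    rw [sub_add_sub_cancel, ← dist_eq_norm, ← dist_eq_norm, ← dist_eq_norm]; linarith
  have h8 := (sameRay_iff_norm_smul_eq.1 (sameRay_iff_norm_add.2 h7))
  rw [h5, h6] at h8
  have hr0 : r ≠ 0 := by linarith
  have h9 : w₀ = c + ε • (r⁻¹ • (c - q)) := by
    rw [smul_comm, h8, smul_smul, inv_mul_cancel₀ hr0, one_smul]; abel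
  rw [← h9]
  linarith

/-- An empty ball touching `S` at `q` can be grown as long as its center stays in the interior of
the set of points with unique nearest points. -/
lemma infDist_ray {S : Set E} (hS : IsClosed S) {q n : E} (hq : q ∈ S) (hn : ‖n‖ = 1) {a b : ℝ}
    (ha : 0 < a) (hab : a ≤ b) (h0 : infDist (q + a • n) S = a)
    (hu : ∀ t ∈ Ico a b, ∀ᶠ w in 𝓝 (q + t • n), HasUniqueNearest S w) :
    infDist (q + b • n) S = b := by
  have hcl : IsClosed {t : ℝ | infDist (q + t • n) S = t} :=
    isClosed_eq ((continuous_infDist_pt S).comp (by fun_prop)) continuous_id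
  -- Continuous induction on `[a, b]`: the good radii form a closed set, and `infDist_extend`
  -- prolongs it to the right.
  have := (hcl.inter (isClosed_Icc (a := a) (b := b))).Icc_subset_of_forall_exists_gt (a := a)
    (b := b) h0 (fun t ht y (hy : t < y) => ?_)
  · exact this ⟨hab, le_rfl⟩
  · have ht0 : 0 < t := ha.trans_le ht.2.1
    have hd : dist (q + t • n) q = t := by
      rw [dist_self_add_left, norm_smul, hn, mul_one, Real.norm_of_nonneg ht0.le]
    have htS : infDist (q + t • n) S = t := ht.1
    obtain ⟨ε, hε, hball⟩ := Metric.eventually_nhds_iff_ball.1 (hu t ht.2)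
    set ε' := min (ε / 2) (min (t / 2) (y - t)) with hε'
    have h1 : 0 < ε' := lt_min (by linarith) (lt_min (by linarith) (by linarith))
    have h2 : ε' ≤ ε / 2 := min_le_left _ _
    have h3 : ε' ≤ t / 2 := (min_le_right _ _).trans (min_le_left _ _)
    have h4 : ε' ≤ y - t := (min_le_right _ _).trans (min_le_right _ _)
    have h5 := infDist_extend hS hq (c := q + t • n) (by rw [htS, hd]) h1 (by rw [hd]; linarith)
      (fun w hw => hball w (ball_subset_ball (by linarith) hw))
    rw [hd, add_sub_cancel_left, inv_smul_smul₀ ht0.ne', add_assoc, ← add_smul] at h5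
    exact ⟨t + ε', h5, by linarith, by linarith⟩

/-- Points of `S` that are joined by a connected set of points with unique nearest points lie in the
same component of `S`. -/
lemma mem_connectedComponentIn_of_hasUniqueNearest {S A : Set E} (hS : IsClosed S)
    (hA : IsPreconnected A) (hu : ∀ w ∈ A, HasUniqueNearest S w) {p q : E} (hp : p ∈ S)
    (hq : q ∈ S) (hpA : p ∈ A) (hqA : q ∈ A) : q ∈ connectedComponentIn S p := by
  have : ProperSpace E := FiniteDimensional.proper_real E
  choose π hπS hπ using fun w => hS.exists_infDist_eq_dist ⟨p, hp⟩ w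
  have hπc : ContinuousOn π A := by
    intro c hc
    rw [ContinuousWithinAt, Metric.tendsto_nhds]
    intro ε hε
    have := (hu c hc).eventually_dist_lt hS (hπS c) (hπ c) hε
    filter_upwards [nhdsWithin_le_nhds this] with w hw
    exact hw _ (hπS w) (hπ w)
  have hfix : ∀ x ∈ S, π x = x := by
    intro x hx
    have := hπ x
    rw [infDist_zero_of_mem hx] at this
    exact (dist_eq_zero.1 this.symm).symm
  have himg := hA.image π hπc
  refine himg.subset_connectedComponentIn ⟨p, hpA, hfix p hp⟩ ?_ ⟨q, hqA, hfix q hq⟩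
  rintro _ ⟨w, -, rfl⟩
  exact hπS w

end NearestPoint

/-! ### Tangent cones and normals of regular level sets -/

section LevelSet

variable {E : Type*} [NormedAddCommGroup E] [InnerProductSpace ℝ E]

lemma exists_eq_smul_of_inner_eq_zero {g n : E} (hg : g ≠ 0)
    (h : ∀ v, inner ℝ g v = 0 → inner ℝ n v = 0) : ∃ a : ℝ, n = a • g := by
  have hgg : inner ℝ g g ≠ 0 := inner_self_ne_zero.2 hg
  set a := inner ℝ g n / inner ℝ g g with ha
  have h1 : inner ℝ g (n - a • g) = 0 := by
    rw [inner_sub_right, real_inner_smul_right, ha]; field_simp; ring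
  have h2 : inner ℝ (n - a • g) (n - a • g) = 0 := by
    rw [inner_sub_left, h _ h1, real_inner_smul_left, h1]; ring
  exact ⟨a, sub_eq_zero.1 (inner_self_eq_zero.1 h2)⟩

variable [FiniteDimensional ℝ E]

/-- The tangent cone of a regular level set is the kernel of the derivative. -/
lemma tangentConeAt_levelSet {S U : Set E} {f : E → ℝ} {f' : E →L[ℝ] ℝ} {x : E}
    (hU : IsOpen U) (hxU : x ∈ U) (hx : x ∈ S) (hSU : S ∩ U = {y ∈ U | f y = 0})
    (hf : HasStrictFDerivAt f f' x) (hf' : f' ≠ 0) :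
    tangentConeAt ℝ S x = {v | f' v = 0} := by
  have hfx : f x = 0 := (hSU.subset ⟨hx, hxU⟩).2
  rw [← tangentConeAt_inter_nhds (hU.mem_nhds hxU), hSU]
  apply Subset.antisymm
  · intro v hv
    obtain ⟨α, l, hl, c, d, hd, hds, hcd⟩ := exists_fun_of_mem_tangentConeAt hv
    have h1 : Tendsto (fun a => f' (c a • d a)) l (𝓝 (f' v)) := (f'.continuous.tendsto v).comp hcd
    have h2 := hf.hasFDerivAt.hasFDerivWithinAt (s := univ) |>.lim hd (by simp) hcd
    have h3 : Tendsto (fun a => c a • (f (x + d a) - f x)) l (𝓝 0) := by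
      refine tendsto_const_nhds.congr' ?_
      filter_upwards [hds] with a ha
      rw [ha.2, hfx]; simp
    exact tendsto_nhds_unique h2 h3
  · intro v hv
    have hrange : f'.range = ⊤ := by
      rw [LinearMap.range_eq_top]
      exact LinearMap.surjective (f := (f' : E →ₗ[ℝ] ℝ)) (fun h => hf' (by
        ext v; exact LinearMap.congr_fun h v))
    -- The implicit function parametrizes the level set over the kernel, so a kernel vector `v` is
    -- the limit of the secants `n • (φ (v / n) - x)`.
    set φ := hf.implicitFunction f f' hrange (f x) with hφ
    have hφd : HasStrictFDerivAt φ f'.ker.subtypeL 0 := hf.to_implicitFunction hrange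
    have hφ0 : φ 0 = x := hf.implicitFunction_apply_image hrange
    have hφf : ∀ᶠ k in 𝓝 (0 : f'.ker), f (φ k) = 0 := by
      have h1 := hf.map_implicitFunction_eq hrange
      have h2 : Tendsto (fun k : f'.ker => (f x, k)) (𝓝 0) (𝓝 (f x, 0)) :=
        (by fun_prop : Continuous fun k : f'.ker => (f x, k)).tendsto 0
      filter_upwards [h2.eventually h1] with k hk
      rw [← hfx]; exact hk
    let v' : f'.ker := ⟨v, hv⟩
    have hseq : Tendsto (fun n : ℕ => ((n : ℝ))⁻¹ • v') atTop (𝓝 0) := by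
      have := (tendsto_inv_atTop_nhds_zero_nat (𝕜 := ℝ)).smul_const v'
      simpa using this
    refine mem_tangentConeAt_of_seq (l := atTop) (fun n : ℕ => (n : ℝ))
      (fun n => φ ((n : ℝ)⁻¹ • v') - x) ?_ ?_ ?_
    · have := (hφd.continuousAt.tendsto.comp hseq).sub_const x
      simpa [hφ0] using this
    · have h1 : Tendsto (fun n : ℕ => φ ((n : ℝ)⁻¹ • v')) atTop (𝓝 x) := by
        have := hφd.continuousAt.tendsto.comp hseq
        rwa [hφ0] at this
      filter_upwards [h1.eventually (hU.mem_nhds hxU), hseq.eventually hφf] with n h2 h3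
      rw [add_sub_cancel]
      exact ⟨h2, h3⟩
    · have := hφd.hasFDerivAt.hasFDerivWithinAt (s := univ) |>.lim (l := atTop)
        (c := fun n : ℕ => (n : ℝ)) (d := fun n : ℕ => (n : ℝ)⁻¹ • v') (v := v') hseq
        (by simp) (by
          refine tendsto_const_nhds.congr' ?_
          filter_upwards [eventually_ne_atTop 0] with n hn
          rw [smul_inv_smul₀ (by exact_mod_cast hn)])
      simpa [hφ0] using this

/-- The vector from a nearest point of a regular level set is a multiple of the gradient. -/
lemma exists_eq_smul_of_infDist_eq {S U : Set E} {f : E → ℝ} {g x w : E}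
    (hU : IsOpen U) (hxU : x ∈ U) (hx : x ∈ S) (hSU : S ∩ U = {y ∈ U | f y = 0})
    (hf : HasStrictFDerivAt f (innerSL ℝ g) x) (hg : g ≠ 0) (hw : infDist w S = dist w x) :
    ∃ a : ℝ, w - x = a • g := by
  have hfx : f x = 0 := (hSU.subset ⟨hx, hxU⟩).2
  have hφ : HasStrictFDerivAt (fun y => ‖y - w‖ ^ 2) (2 • (innerSL ℝ (x - w))) x := by
    exact (hasStrictFDerivAt_norm_sq (x - w)).comp x ((hasStrictFDerivAt_id x).sub_const w)
  have hext : IsLocalExtrOn (fun y => ‖y - w‖ ^ 2) {y | f y = f x} x := by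
    left
    filter_upwards [self_mem_nhdsWithin, nhdsWithin_le_nhds (hU.mem_nhds hxU)] with y hy hyU
    have hyS : y ∈ S := (hSU.superset ⟨hyU, by rw [hy, hfx]⟩).1
    have h1 : dist w x ≤ dist w y := hw ▸ infDist_le_dist_of_mem hyS
    rw [dist_comm, dist_eq_norm, dist_comm, dist_eq_norm] at h1
    gcongr
  obtain ⟨a, b, hab, h⟩ := hext.exists_multipliers_of_hasStrictFDerivAt_1d hf hφ
  have h' : ∀ v, a * inner ℝ g v + b * (2 * inner ℝ (x - w) v) = 0 := by
    intro v
    have := DFunLike.congr_fun h v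
    simpa [inner_sub_left] using this
  -- Otherwise the multiplier relation tested on `g` would also kill `a`.
  have hb : b ≠ 0 := by
    rintro rfl
    have h1 := h' g
    have hgg : inner ℝ g g ≠ 0 := inner_self_ne_zero.2 hg
    simp only [zero_mul, add_zero, mul_eq_zero, hgg, or_false] at h1
    exact hab (by rw [h1]; rfl)
  refine exists_eq_smul_of_inner_eq_zero hg fun v hv => ?_
  have h1 := h' v
  rw [hv, mul_zero, zero_add] at h1
  have h2 : inner ℝ (x - w) v = 0 := by simpa [hb] using h1
  rw [← neg_sub, inner_neg_left, h2, neg_zero]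

end LevelSet

/-! ### Quadratic contact with tangent spaces and its consequences -/

section Hypersurface

variable {d : ℕ} {S : Set (EuclideanSpace ℝ (Fin d))}

/-- Near each of its points, a hypersurface has normal vectors `g` such that the distance to the
tangent space is bounded quadratically, uniformly in the point of tangency. -/
lemma IsClosedHypersurface.exists_local_normal (hS : IsClosedHypersurface S)
    {p : EuclideanSpace ℝ (Fin d)} (hp : p ∈ S) :
    ∃ ρ > 0, ∃ K > 0, ∀ x ∈ S, dist x p < ρ → ∃ g ≠ 0,
      tangentConeAt ℝ S x = {v | inner ℝ g v = 0} ∧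
      (∀ y ∈ S, dist y p < ρ → |inner ℝ g (y - x)| ≤ K * ‖g‖ * ‖y - x‖ ^ 2) ∧
      ∀ w, infDist w S = dist w x → ∃ a : ℝ, w - x = a • g := by
  obtain ⟨U, f, hU, hpU, hf, hf', hSU⟩ := hS.locally_zero_set p hp
  have hfp : ContDiffAt ℝ 2 f p := hf.contDiffAt (hU.mem_nhds hpU)
  have hfd : ContDiffAt ℝ 1 (fderiv ℝ f) p := hfp.fderiv_right (by norm_num)
  obtain ⟨L, t, ht, hL⟩ := hfd.exists_lipschitzOnWith
  have hm : ∀ᶠ x in 𝓝 p, ‖fderiv ℝ f p‖ / 2 < ‖fderiv ℝ f x‖ := by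
    refine hfd.continuousAt.norm.eventually_const_lt ?_
    have := norm_pos_iff.2 hf'
    linarith
  obtain ⟨ρ, hρ, hball⟩ := Metric.eventually_nhds_iff.1
    (((hU.eventually_mem hpU).and ht).and hm)
  have hm0 : 0 < ‖fderiv ℝ f p‖ := norm_pos_iff.2 hf'
  -- Near `p` the gradient norm exceeds half its value at `p`, so `L ≤ K * ‖g‖`; the `+ 1` keeps `K`
  -- positive even if `L = 0`.
  set K : ℝ := (L + 1) / (‖fderiv ℝ f p‖ / 2) with hK
  refine ⟨ρ, hρ, K, by positivity, fun x hx hxρ => ?_⟩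
  obtain ⟨⟨hxU, hxt⟩, hxm⟩ := hball hxρ
  set g := (InnerProductSpace.toDual ℝ _).symm (fderiv ℝ f x) with hg
  have hgf : innerSL ℝ g = fderiv ℝ f x := by
    ext v; simp [hg]
  have hgn : ‖g‖ = ‖fderiv ℝ f x‖ := by simp [hg]
  have hg0 : g ≠ 0 := norm_pos_iff.1 (by rw [hgn]; linarith)
  have hfx : HasStrictFDerivAt f (innerSL ℝ g) x := by
    rw [hgf]
    exact (hf.contDiffAt (hU.mem_nhds hxU)).hasStrictFDerivAt (by norm_num)
  refine ⟨g, hg0, ?_, ?_, ?_⟩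
  · have := tangentConeAt_levelSet hU hxU hx hSU hfx (by
      rw [hgf]; exact norm_pos_iff.1 (by linarith))
    simpa using this
  · intro y hy hyρ
    have hfx0 : f x = 0 := (hSU.subset ⟨hx, hxU⟩).2
    have hfy0 : f y = 0 := (hSU.subset ⟨hy, (hball hyρ).1.1⟩).2
    have hseg : ∀ z ∈ segment ℝ x y, dist z p < ρ := fun z hz =>
      (convex_ball p ρ).segment_subset hxρ hyρ hz
    have h1 := Convex.norm_image_sub_le_of_norm_fderiv_le' (𝕜 := ℝ) (f := f) (s := segment ℝ x y)
      (φ := fderiv ℝ f x) (C := L * ‖y - x‖)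
      (fun z hz => (hf.contDiffAt (hU.mem_nhds (hball (hseg z hz)).1.1)).differentiableAt
        (by norm_num))
      (fun z hz => by
        have h2 := hL.dist_le_mul z (hball (hseg z hz)).1.2 x hxt
        rw [dist_eq_norm, dist_eq_norm] at h2
        refine h2.trans ?_
        gcongr
        exact norm_sub_le_of_mem_segment hz)
      (convex_segment x y) (left_mem_segment ℝ x y) (right_mem_segment ℝ x y)
    rw [hfx0, hfy0, ← hgf, sub_zero, zero_sub, norm_neg, innerSL_apply_apply,
      Real.norm_eq_abs] at h1
    refine h1.trans ?_
    have h3 : (L : ℝ) ≤ K * ‖g‖ := by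
      have : K * (‖fderiv ℝ f p‖ / 2) = L + 1 := by rw [hK]; field_simp
      have : K * (‖fderiv ℝ f p‖ / 2) ≤ K * ‖g‖ := by
        rw [hgn]
        have : 0 < K := by positivity
        gcongr
      linarith
    nlinarith [sq_nonneg ‖y - x‖]
  · exact fun w hw => exists_eq_smul_of_infDist_eq hU hxU hx hSU hfx hg0 hw

/-- If a ball misses `S` and its sphere meets `S`, its radius is forced to be the distance from the
center to `S`. -/
lemma medialAxis_eq_closure : medialAxis S = closure {w | ¬ HasUniqueNearest S w} := by
  unfold medialAxis HasUniqueNearest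
  congr 1
  ext w
  rw [mem_ofPred_eq, mem_ofPred_eq, Set.not_subsingleton_iff]
  constructor
  · rintro ⟨r, hr, hnt⟩
    obtain ⟨y, hy, hyS⟩ := hnt.nonempty
    have h1 : infDist w S ≤ r := by
      rw [mem_sphere, dist_comm] at hy
      exact hy ▸ infDist_le_dist_of_mem hyS
    have h2 : r ≤ infDist w S := (le_infDist ⟨y, hyS⟩).2 fun z hz => by
      by_contra! hlt
      exact Set.disjoint_left.1 hr (by rwa [mem_ball, dist_comm]) hz
    rwa [le_antisymm h1 h2]
  · exact fun h => ⟨_, disjoint_ball_infDist, h⟩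

lemma eventually_hasUniqueNearest {w : EuclideanSpace ℝ (Fin d)} (hw : w ∉ medialAxis S) :
    ∀ᶠ z in 𝓝 w, HasUniqueNearest S z := by
  have : IsClosed (medialAxis S) := isClosed_closure
  filter_upwards [this.isOpen_compl.mem_nhds hw] with z hz
  by_contra h
  exact hz (medialAxis_eq_closure ▸ subset_closure h)

/-- A hypersurface does not meet its medial axis. -/
lemma IsClosedHypersurface.notMem_medialAxis (hS : IsClosedHypersurface S)
    {p : EuclideanSpace ℝ (Fin d)} (hp : p ∈ S) : p ∉ medialAxis S := by
  obtain ⟨ρ, hρ, K, hK, hloc⟩ := hS.exists_local_normal hp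
  rw [medialAxis_eq_closure, Metric.mem_closure_iff]
  push Not
  -- `ρ / 2` brings both nearest points into the region of the quadratic bound. With `1 / (4 * K)`,
  -- equal distances would give `‖y - x‖ ^ 2 = 2 * inner (w - x) (y - x) < ‖y - x‖ ^ 2 / 2`.
  set ε := min (ρ / 2) (1 / (4 * K)) with hε
  refine ⟨ε, by positivity, fun w hw => ?_⟩
  by_contra! hlt
  refine hw fun x hx y hy => ?_
  obtain ⟨hxw, hxS⟩ := hx
  obtain ⟨hyw, hyS⟩ := hy
  rw [mem_sphere, dist_comm] at hxw hyw
  by_contra hxy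
  have hr : infDist w S ≤ dist w p := infDist_le_dist_of_mem hp
  rw [dist_comm] at hlt
  have h1 : ε ≤ ρ / 2 := min_le_left _ _
  have h2 : ε ≤ 1 / (4 * K) := min_le_right _ _
  have hxp : dist x p < ρ := by
    have := dist_triangle_left x p w
    linarith
  have hyp : dist y p < ρ := by
    have := dist_triangle_left y p w
    linarith
  obtain ⟨g, hg, -, hquad, hnear⟩ := hloc x hxS hxp
  obtain ⟨a, ha⟩ := hnear w hxw.symm
  have h3 := hquad y hyS hyp
  have h4 : ‖w - x‖ < 1 / (4 * K) := by rw [← dist_eq_norm]; linarith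
  have h5 : ‖w - y‖ ^ 2 = ‖w - x‖ ^ 2 := by rw [← dist_eq_norm, ← dist_eq_norm, hxw, hyw]
  have h6 : ‖w - y‖ ^ 2 = ‖w - x‖ ^ 2 - 2 * inner ℝ (w - x) (y - x) + ‖y - x‖ ^ 2 := by
    rw [← norm_sub_sq_real, sub_sub_sub_cancel_right]
  have h7 : 0 < ‖y - x‖ := norm_pos_iff.2 (sub_ne_zero.2 (Ne.symm hxy))
  have h8 : inner ℝ (w - x) (y - x) ≤ ‖w - x‖ * (K * ‖y - x‖ ^ 2) := by
    rw [ha, real_inner_smul_left, norm_smul, Real.norm_eq_abs]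
    calc a * inner ℝ g (y - x) ≤ |a * inner ℝ g (y - x)| := le_abs_self _
      _ = |a| * |inner ℝ g (y - x)| := abs_mul _ _
      _ ≤ |a| * (K * ‖g‖ * ‖y - x‖ ^ 2) := by gcongr
      _ = _ := by ring
  have h9 : ‖w - x‖ * K < 1 / 4 := by
    rw [lt_div_iff₀ (by positivity)] at h4; linarith
  nlinarith [pow_pos h7 2]

/-- Small balls that touch a hypersurface from one side are empty. -/
lemma IsClosedHypersurface.exists_infDist_eq (hS : IsClosedHypersurface S)
    {q n : EuclideanSpace ℝ (Fin d)} (hq : q ∈ S) (hn : ‖n‖ = 1) (hnq : IsNormalAt S q n) :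
    ∃ a > 0, ∀ t, 0 ≤ t → t ≤ a → infDist (q + t • n) S = t := by
  obtain ⟨ρ, hρ, K, hK, hloc⟩ := hS.exists_local_normal hq
  obtain ⟨g, hg, hcone, hquad, -⟩ := hloc q hq (by simpa)
  obtain ⟨c, hc⟩ := exists_eq_smul_of_inner_eq_zero (n := n) hg fun v hv =>
    hnq v (by rw [hcone]; exact hv)
  -- `1 / (2 * K)` handles the points of `S` within `ρ` of `q`; for the others, `ρ / 2` and the
  -- triangle inequality suffice.
  refine ⟨min (ρ / 2) (1 / (2 * K)), by positivity, fun t ht0 hta => ?_⟩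
  have h1 := hta.trans (min_le_left _ _)
  have h2 := hta.trans (min_le_right _ _)
  rw [le_div_iff₀ (by positivity)] at h2
  have hd : dist (q + t • n) q = t := by
    rw [dist_self_add_left, norm_smul, hn, mul_one, Real.norm_of_nonneg ht0]
  apply le_antisymm
  · exact (infDist_le_dist_of_mem hq).trans_eq hd
  · refine (le_infDist ⟨q, hq⟩).2 fun y hy => ?_
    rcases lt_or_ge (dist y q) ρ with hyq | hyq
    · have h3 := hquad y hy hyq
      have h4 : inner ℝ n (y - q) ≤ K * ‖y - q‖ ^ 2 := by
        have : |c| * ‖g‖ = 1 := by rw [← hn, hc, norm_smul, Real.norm_eq_abs]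
        rw [hc, real_inner_smul_left]
        calc c * inner ℝ g (y - q) ≤ |c * inner ℝ g (y - q)| := le_abs_self _
          _ = |c| * |inner ℝ g (y - q)| := abs_mul _ _
          _ ≤ |c| * (K * ‖g‖ * ‖y - q‖ ^ 2) := by gcongr
          _ = (|c| * ‖g‖) * (K * ‖y - q‖ ^ 2) := by ring
          _ = _ := by rw [this, one_mul]
      have h5 : dist (q + t • n) y ^ 2 = t ^ 2 - 2 * t * inner ℝ n (y - q) + ‖y - q‖ ^ 2 := by
        rw [dist_eq_norm, show q + t • n - y = t • n - (y - q) by abel, norm_sub_sq_real,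
          norm_smul, hn, real_inner_smul_left, Real.norm_of_nonneg ht0]
        ring
      refine le_of_sq_le_sq ?_ dist_nonneg
      rw [h5]
      nlinarith [sq_nonneg ‖y - q‖, mul_le_mul_of_nonneg_left h4 ht0]
    · have := dist_triangle_left y q (q + t • n)
      linarith

lemma infDist_tangentFlat {p e : EuclideanSpace ℝ (Fin d)} (he : ‖e‖ = 1)
    (hcone : tangentConeAt ℝ S p = {v | inner ℝ e v = 0}) (q : EuclideanSpace ℝ (Fin d)) :
    infDist q (tangentFlat S p) = |inner ℝ e (q - p)| := by
  have hee : inner ℝ e e = 1 := by rw [real_inner_self_eq_norm_sq, he, one_pow]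
  have hmem : p + ((q - p) - (inner ℝ e (q - p) : ℝ) • e) ∈ tangentFlat S p := by
    refine ⟨_, ?_, rfl⟩
    rw [hcone, mem_ofPred_eq, inner_sub_right, real_inner_smul_right, hee]; ring
  apply le_antisymm
  · refine (infDist_le_dist_of_mem hmem).trans_eq ?_
    rw [dist_eq_norm, show q - (p + ((q - p) - (inner ℝ e (q - p) : ℝ) • e)) =
      (inner ℝ e (q - p) : ℝ) • e by abel, norm_smul, he, mul_one, Real.norm_eq_abs]
  · refine (le_infDist ⟨_, hmem⟩).2 ?_
    rintro _ ⟨v, hv, rfl⟩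
    rw [hcone] at hv
    have h1 := abs_real_inner_le_norm e (q - (p + v))
    rw [he, one_mul, ← dist_eq_norm, ← sub_sub, inner_sub_right, (hv : inner ℝ e v = 0),
      sub_zero] at h1
    exact h1

lemma IsClosedHypersurface.tangentConeAt_eq (hS : IsClosedHypersurface S)
    {p e : EuclideanSpace ℝ (Fin d)} (hp : p ∈ S) (he : e ≠ 0) (hep : IsNormalAt S p e) :
    tangentConeAt ℝ S p = {v | inner ℝ e v = 0} := by
  obtain ⟨ρ, hρ, K, hK, hloc⟩ := hS.exists_local_normal hp
  obtain ⟨g, hg, hcone, -, -⟩ := hloc p hp (by simpa)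
  obtain ⟨c, rfl⟩ := exists_eq_smul_of_inner_eq_zero (n := e) hg fun v hv =>
    hep v (by rw [hcone]; exact hv)
  have hc : c ≠ 0 := by rintro rfl; simp at he
  rw [hcone]
  ext v
  simp [real_inner_smul_left, hc]

end Hypersurface

/-! ### Inside, outside, and the tangent balls on either side -/

section Orientation

variable {d : ℕ} {S C A : Set (EuclideanSpace ℝ (Fin d))} {p q n x : EuclideanSpace ℝ (Fin d)}

lemma disjoint_outside_inside : Disjoint (outside C) (inside C) :=
  Set.disjoint_left.2 fun _ h h' => h.2 h'.2

lemma connectedComponentIn_compl_eq (hA : IsPreconnected A) (hAC : Disjoint A C) (hx : x ∈ A)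
    {y : EuclideanSpace ℝ (Fin d)} (hy : y ∈ A) :
    connectedComponentIn Cᶜ x = connectedComponentIn Cᶜ y :=
  connectedComponentIn_eq
    (hA.subset_connectedComponentIn hx (Set.subset_compl_iff_disjoint_right.2 hAC) hy)

lemma subset_outside (hA : IsPreconnected A) (hAC : Disjoint A C) (hx : x ∈ A)
    (hxC : x ∈ outside C) : A ⊆ outside C := fun _ hy =>
  ⟨Set.disjoint_left.1 hAC hy, connectedComponentIn_compl_eq hA hAC hx hy ▸ hxC.2⟩

lemma subset_inside (hA : IsPreconnected A) (hAC : Disjoint A C) (hx : x ∈ A)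
    (hxC : x ∈ inside C) : A ⊆ inside C := fun _ hy =>
  ⟨Set.disjoint_left.1 hAC hy, connectedComponentIn_compl_eq hA hAC hx hy ▸ hxC.2⟩

lemma tendsto_const_mul_nhdsGT_zero {c : ℝ} (hc : 0 < c) :
    Tendsto (fun t : ℝ => t * c) (𝓝[>] 0) (𝓝[>] 0) := by
  refine tendsto_nhdsWithin_iff.2 ⟨?_, ?_⟩
  · have : Tendsto (fun t : ℝ => t * c) (𝓝 0) (𝓝 (0 * c)) :=
      (by fun_prop : Continuous fun t : ℝ => t * c).tendsto 0
    rw [zero_mul] at this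
    exact this.mono_left nhdsWithin_le_nhds
  · filter_upwards [self_mem_nhdsWithin] with t ht
    exact mul_pos ht hc

lemma IsOutwardNormal.smul (h : IsOutwardNormal S p n) {c : ℝ} (hc : 0 < c) :
    IsOutwardNormal S p (c • n) where
  ne_zero := smul_ne_zero hc.ne' h.ne_zero
  isNormalAt := fun v hv => by rw [real_inner_smul_left, h.isNormalAt v hv, mul_zero]
  outward := by
    filter_upwards [(tendsto_const_mul_nhdsGT_zero hc).eventually h.outward] with t ht
    rwa [smul_smul]

lemma IsNormalAt.neg (h : IsNormalAt S p n) : IsNormalAt S p (-n) := fun v hv => by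
  rw [inner_neg_left, h v hv, neg_zero]

lemma disjoint_ball_connectedComponentIn {w : EuclideanSpace ℝ (Fin d)} {t : ℝ}
    (h : infDist w S = t) (p : EuclideanSpace ℝ (Fin d)) :
    Disjoint (ball w t) (connectedComponentIn S p) :=
  (h ▸ disjoint_ball_infDist).mono_right (connectedComponentIn_subset S p)

lemma add_smul_mem_ball (hn : ‖n‖ = 1) {s t : ℝ} (hs : 0 < s) (hst : s < t) :
    q + s • n ∈ ball (q + t • n) t := by
  rw [mem_ball, dist_add_left, dist_eq_norm, ← sub_smul, norm_smul, hn, mul_one,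
    Real.norm_eq_abs, abs_lt]
  constructor <;> linarith

/-- The ball is connected and misses the component, so a single point `q + s • n` with small `s`
decides for all of it. -/
lemma IsOutwardNormal.ball_subset_outside (h : IsOutwardNormal S q n) (hn : ‖n‖ = 1) {t : ℝ}
    (ht : 0 < t) (hq : infDist (q + t • n) S = t) :
    ball (q + t • n) t ⊆ outside (connectedComponentIn S q) := by
  obtain ⟨s, ⟨hs, hst⟩, hs0 : 0 < s⟩ :=
    ((h.outward.and (nhdsWithin_le_nhds (eventually_lt_nhds ht))).and self_mem_nhdsWithin).exists
  exact subset_outside (convex_ball _ _).isPreconnected (disjoint_ball_connectedComponentIn hq q)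
    (add_smul_mem_ball hn hs0 hst) hs.1

lemma IsOutwardNormal.ball_subset_inside (h : IsOutwardNormal S q n) (hn : ‖n‖ = 1) {t : ℝ}
    (ht : 0 < t) (hq : infDist (q + t • -n) S = t) :
    ball (q + t • -n) t ⊆ inside (connectedComponentIn S q) := by
  obtain ⟨s, ⟨hs, hst⟩, hs0 : 0 < s⟩ :=
    ((h.outward.and (nhdsWithin_le_nhds (eventually_lt_nhds ht))).and self_mem_nhdsWithin).exists
  refine subset_inside (convex_ball _ _).isPreconnected (disjoint_ball_connectedComponentIn hq q)
    (add_smul_mem_ball (by rwa [norm_neg]) hs0 hst) ?_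
  rw [smul_neg, ← sub_eq_add_neg]
  exact hs.2

/-- A point of maximal distance from `S` in a bounded component of the complement belongs to the
medial axis. -/
lemma IsClosedHypersurface.medialAxis_nonempty (hS : IsClosedHypersurface S) (hp : p ∈ S)
    (hn : ‖n‖ = 1) (h : IsOutwardNormal S p n) : (medialAxis S).Nonempty := by
  by_contra! hM
  obtain ⟨a, ha, hball⟩ := hS.exists_infDist_eq hp (n := -n) (by rwa [norm_neg]) h.isNormalAt.neg
  set C := connectedComponentIn S p with hC
  have hCS : C ⊆ S := connectedComponentIn_subset S p
  have hSc : IsClosed S := hS.isCompact.isClosed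
  have hCc : IsClosed C := isClosed_of_closure_subset <|
    isPreconnected_connectedComponentIn.closure.subset_connectedComponentIn
      (subset_closure (mem_connectedComponentIn hp)) (closure_minimal hCS hSc)
  set x := p + a • -n with hx
  have hxa : infDist x S = a := hball a ha.le le_rfl
  have hxin : x ∈ inside C := h.ball_subset_inside hn ha hxa (mem_ball_self ha)
  set V := connectedComponentIn Cᶜ x with hV
  have hVo : IsOpen V := hCc.isOpen_compl.connectedComponentIn
  have hxV : x ∈ V := mem_connectedComponentIn hxin.1
  have hVc : IsCompact (closure V) := hxin.2.isCompact_closure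
  obtain ⟨w, hw, hmax⟩ := hVc.exists_isMaxOn ⟨x, subset_closure hxV⟩ (f := fun w => infDist w S)
    (continuous_infDist_pt S).continuousOn
  have h1 : a ≤ infDist w S := hxa ▸ hmax (subset_closure hxV)
  have hwS : w ∉ S := fun hwS => by
    rw [infDist_zero_of_mem hwS] at h1; linarith
  have hwV : w ∈ V := by
    -- Adding a closure point keeps `V` connected, and `w` avoids `C`; hence `w` already lies in the
    -- open set `V` and can be moved within it.
    have h2 : IsPreconnected (insert w V) := isPreconnected_connectedComponentIn.subset_closure
      (subset_insert _ _) (insert_subset hw subset_closure)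
    refine h2.subset_connectedComponentIn (mem_insert_of_mem _ hxV) ?_ (mem_insert _ _)
    exact insert_subset (fun hwC => hwS (hCS hwC)) (connectedComponentIn_subset _ _)
  have hu : HasUniqueNearest S w :=
    (eventually_hasUniqueNearest (by rw [hM]; exact notMem_empty w)).self_of_nhds
  obtain ⟨y, hy, hwy⟩ := hSc.exists_infDist_eq_dist ⟨p, hp⟩ w
  have h3 := hu.eventually_infDist_ge hSc hy hwy hwS (κ := 1 / 2) (by norm_num)
  set u := (dist w y)⁻¹ • (w - y)
  have ht : Tendsto (fun t : ℝ => w + t • u) (𝓝[>] 0) (𝓝 w) := by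
    have : Tendsto (fun h : ℝ => w + h • u) (𝓝 0) (𝓝 (w + (0 : ℝ) • u)) :=
      (by fun_prop : Continuous fun h : ℝ => w + h • u).tendsto 0
    simp only [zero_smul, add_zero] at this
    exact this.mono_left nhdsWithin_le_nhds
  obtain ⟨t, ⟨h4, h5⟩, h6 : 0 < t⟩ :=
    ((h3.and (ht.eventually (hVo.mem_nhds hwV))).and self_mem_nhdsWithin).exists
  have h7 : infDist (w + t • u) S ≤ infDist w S := hmax (subset_closure h5)
  linarith

lemma hasUniqueNearest_of_mem_ball_lfs {w : EuclideanSpace ℝ (Fin d)} (hw : w ∈ ball p (lfs S p)) :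
    ∀ᶠ z in 𝓝 w, HasUniqueNearest S z := by
  refine eventually_hasUniqueNearest fun hwM => ?_
  have := infDist_le_dist_of_mem (x := p) hwM
  rw [mem_ball, dist_comm, lfs] at hw
  linarith

/-- A ball that touches `S` at `q` and whose center has at most the distance `lfs S p` from `p`
is empty. -/
lemma IsClosedHypersurface.infDist_add_smul (hS : IsClosedHypersurface S) (hq : q ∈ S)
    (hn : ‖n‖ = 1) (hnq : IsNormalAt S q n) (hpq : dist q p < lfs S p) {t : ℝ} (ht : 0 < t)
    (htp : dist (q + t • n) p ≤ lfs S p) : infDist (q + t • n) S = t := by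
  obtain ⟨a, ha, hball⟩ := hS.exists_infDist_eq hq hn hnq
  have hm : 0 < min a t := lt_min ha ht
  refine infDist_ray hS.isCompact.isClosed hq hn hm (min_le_right _ _)
    (hball _ hm.le (min_le_left _ _)) fun s hs => hasUniqueNearest_of_mem_ball_lfs (p := p) ?_
  have hs0 : 0 ≤ s := hm.le.trans hs.1
  have h1 : s / t < 1 := (div_lt_one ht).2 hs.2
  have h0 : 0 ≤ s / t := by positivity
  have h2 : q + s • n - p = (1 - s / t) • (q - p) + (s / t) • (q + t • n - p) := by
    rw [show q + t • n - p = (q - p) + t • n by abel, smul_add, smul_smul, div_mul_cancel₀ _ ht.ne',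
      sub_smul, one_smul]
    abel
  rw [mem_ball, dist_eq_norm, h2]
  refine (norm_add_le _ _).trans_lt ?_
  rw [norm_smul, norm_smul, Real.norm_of_nonneg h0, Real.norm_of_nonneg (by linarith),
    ← dist_eq_norm, ← dist_eq_norm]
  nlinarith

/-- The orientations at `p` and `q` refer to their own components; the tangent balls at the two
points are comparable only because these coincide. -/
lemma IsClosedHypersurface.connectedComponentIn_eq (hS : IsClosedHypersurface S) (hp : p ∈ S)
    (hq : q ∈ S) (hpq : dist q p < lfs S p) :
    connectedComponentIn S p = connectedComponentIn S q :=
  _root_.connectedComponentIn_eq <| mem_connectedComponentIn_of_hasUniqueNearest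
    (A := ball p (lfs S p)) hS.isCompact.isClosed (convex_ball _ _).isPreconnected
    (fun _ hw => (hasUniqueNearest_of_mem_ball_lfs hw).self_of_nhds) hp hq
    (mem_ball_self (dist_nonneg.trans_lt hpq)) hpq

lemma add_le_dist_of_disjoint_ball {x y : EuclideanSpace ℝ (Fin d)} {r s : ℝ} (hr : 0 < r)
    (hs : 0 < s) (h : Disjoint (ball x r) (ball y s)) : r + s ≤ dist x y :=
  (disjoint_ball_ball_iff hr hs).1 h

end Orientation

/-! ### Optimizing over the two radii -/

section RealInequalities

/-- Solved for `c`, the hypothesis `h` gives a lower bound that increases with `s` because `1 + 2 *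
a ≥ 0`. So `s` may be lowered to `s₀`, where it takes the stated form. -/
lemma one_sub_div_le_of_le {D a s s₀ c : ℝ} (hD : D < 1) (ha : |a| ≤ D / 2) (hs₀ : 0 < s₀)
    (hs : s₀ ≤ s) (hs₀sq : s₀ ^ 2 * (2 - D - 2 * a) = (2 - D + 2 * a) * (1 - D))
    (h : (1 + s) ^ 2 ≤ 2 + 2 * a + 2 * s * c) :
    1 - (D - D ^ 2 / 2 - 2 * a ^ 2) / (s₀ * (2 - D - 2 * a)) ≤ c := by
  obtain ⟨ha1, ha2⟩ := abs_le.1 ha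
  have hpos : 0 < 2 - D - 2 * a := by linarith
  have hs' : 0 < s := hs₀.trans_le hs
  have h1 : (D - D ^ 2 / 2 - 2 * a ^ 2) / (s₀ * (2 - D - 2 * a)) =
      (1 + 2 * a - s₀ ^ 2) / (2 * s₀) := by
    rw [div_eq_div_iff (by positivity) (by positivity)]
    linear_combination s₀ * hs₀sq
  have h2 : 1 - (1 + 2 * a - s ^ 2) / (2 * s) ≤ c := by
    rw [sub_le_comm, le_div_iff₀ (by positivity)]
    linarith
  have h3 : (1 + 2 * a - s ^ 2) / (2 * s) ≤ (1 + 2 * a - s₀ ^ 2) / (2 * s₀) := by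
    rw [div_le_div_iff₀ (by positivity) (by positivity)]
    nlinarith [mul_nonneg (sub_nonneg.2 hs) (by linarith : 0 ≤ 1 + 2 * a),
      mul_nonneg (sub_nonneg.2 hs) (mul_pos hs₀ hs').le]
  rw [h1]
  linarith

/-- The trade-off between the conditions of two pairs of disjoint balls. -/
lemma one_sub_div_sqrt_le {D a s s' c : ℝ} (hD : D < 1) (ha : |a| ≤ D / 2)
    (hs' : 0 < s') (hss : s * s' = 1 - D) (h : (1 + s) ^ 2 ≤ 2 + 2 * a + 2 * s * c)
    (h' : (1 + s') ^ 2 ≤ 2 - 2 * a + 2 * s' * c) :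
    1 - (D - D ^ 2 / 2 - 2 * a ^ 2) / √((1 - D) * ((2 - D) ^ 2 - 4 * a ^ 2)) ≤ c := by
  obtain ⟨ha1, ha2⟩ := abs_le.1 ha
  have h1 : 0 < 2 - D - 2 * a := by linarith
  have h2 : 0 < 2 - D + 2 * a := by linarith
  have h3 : 0 < 1 - D := by linarith
  set R := √((1 - D) * ((2 - D) ^ 2 - 4 * a ^ 2)) with hR
  have hprod : (1 - D) * ((2 - D) ^ 2 - 4 * a ^ 2) =
      (1 - D) * ((2 - D - 2 * a) * (2 - D + 2 * a)) := by ring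
  have hR0 : 0 < R := Real.sqrt_pos.2 (by rw [hprod]; positivity)
  have hRsq : R ^ 2 = (1 - D) * ((2 - D) ^ 2 - 4 * a ^ 2) :=
    Real.sq_sqrt (by rw [hprod]; positivity)
  -- `R / (2 - D - 2 * a)` and `R / (2 - D + 2 * a)` are the critical values of `s` and `s'`, where
  -- the two bounds agree. Their product is `1 - D`, so `s` or `s'` reaches its critical value.
  have e1 : (R / (2 - D - 2 * a)) ^ 2 * (2 - D - 2 * a) = (2 - D + 2 * a) * (1 - D) := by
    rw [div_pow, hRsq]; field_simp; ring
  have e2 : (R / (2 - D + 2 * a)) ^ 2 * (2 - D + 2 * a) = (2 - D - 2 * a) * (1 - D) := by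
    rw [div_pow, hRsq]; field_simp; ring
  have e3 : R / (2 - D - 2 * a) * (R / (2 - D + 2 * a)) = 1 - D := by
    rw [div_mul_div_comm, ← sq, hRsq]; field_simp; ring
  rcases le_total (R / (2 - D - 2 * a)) s with h4 | h4
  · have := one_sub_div_le_of_le hD ha (by positivity) h4 e1 h
    rwa [div_mul_cancel₀ _ h1.ne'] at this
  · have h5 : R / (2 - D + 2 * a) ≤ s' := by
      by_contra! hlt
      have : s * s' < R / (2 - D - 2 * a) * (R / (2 - D + 2 * a)) :=
        mul_lt_mul' h4 hlt hs'.le (by positivity)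
      linarith
    have := one_sub_div_le_of_le (a := -a) (c := c) hD (by rwa [abs_neg]) (by positivity) h5
      (by linear_combination e2) (by linarith)
    rw [show 2 - D - 2 * -a = 2 - D + 2 * a by ring, div_mul_cancel₀ _ h2.ne', neg_sq] at this
    exact this

lemma eta1N_bound_numerator {D a : ℝ} (hD : D < 1) (ha : |a| ≤ D / 2) :
    0 ≤ (D - D ^ 2 / 2 - 2 * a ^ 2) / √((1 - D) * ((2 - D) ^ 2 - 4 * a ^ 2)) := by
  have hD0 : 0 ≤ D := by linarith [abs_nonneg a]
  obtain ⟨ha1, ha2⟩ := abs_le.1 ha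
  apply div_nonneg _ (Real.sqrt_nonneg _)
  nlinarith

/-- After clearing the common `√(1 - D)`, the squares of the two sides differ by `4a²(2D(2 - D) -
4a² - D²)`, which is positive since `4a² ≤ D²` and `D < 1`. -/
lemma eta1N_argument_lt {D a : ℝ} (hD : D < 1) (ha : |a| ≤ D / 2) (ha0 : a ≠ 0) :
    (D - D ^ 2 / 2 - 2 * a ^ 2) / √((1 - D) * ((2 - D) ^ 2 - 4 * a ^ 2)) < D / (2 * √(1 - D)) := by
  obtain ⟨ha1, ha2⟩ := abs_le.1 ha
  have hD0 : 0 < D := by linarith [abs_pos.2 ha0]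
  have h3 : 0 < 1 - D := by linarith
  have ha4 : 4 * a ^ 2 ≤ D ^ 2 := by nlinarith
  have hasq : 0 < a ^ 2 := by positivity
  have hpos : 0 < (2 - D) ^ 2 - 4 * a ^ 2 := by nlinarith
  rw [Real.sqrt_mul h3.le]
  have hs : 0 < √(1 - D) := Real.sqrt_pos.2 h3
  have hr : 0 < √((2 - D) ^ 2 - 4 * a ^ 2) := Real.sqrt_pos.2 hpos
  rw [div_lt_div_iff₀ (by positivity) (by positivity)]
  have key : D * (2 - D) - 4 * a ^ 2 < D * √((2 - D) ^ 2 - 4 * a ^ 2) := by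
    apply lt_of_pow_lt_pow_left₀ 2 (by positivity)
    rw [mul_pow, Real.sq_sqrt hpos.le]
    have : 0 < 4 * a ^ 2 * (2 * D * (2 - D) - 4 * a ^ 2 - D ^ 2) := by
      apply mul_pos (by positivity)
      nlinarith
    nlinarith
  nlinarith

/-- The threshold solves `δ² = 4√(1 - δ²)`, that is `δ⁴ + 16δ² - 16 = 0`: there the argument of
`arccos` in `eta1` reaches `-1`. Below it `arccos` is strictly decreasing and not clamped. -/
lemma sq_lt_one_of_lt_sqrt {δ : ℝ} (h0 : 0 ≤ δ) (h : δ < √(4 * √5 - 8)) :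
    δ ^ 2 < 1 ∧ δ ^ 2 / (2 * √(1 - δ ^ 2)) < 2 := by
  have h5 : √5 ^ 2 = 5 := Real.sq_sqrt (by norm_num)
  have h5' : √5 < 9 / 4 := by
    rw [Real.sqrt_lt' (by norm_num)]; norm_num
  have h6 : 2 < √5 := by
    rw [Real.lt_sqrt (by norm_num)]; norm_num
  have h1 : δ ^ 2 < 4 * √5 - 8 := (Real.lt_sqrt h0).1 h
  have h2 : δ ^ 2 < 1 := by linarith
  refine ⟨h2, ?_⟩
  have hpos : 0 < 1 - δ ^ 2 := by linarith
  rw [div_lt_iff₀ (by positivity)]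
  have h3 : δ ^ 2 / 4 < √(1 - δ ^ 2) := by
    rw [Real.lt_sqrt (by positivity)]
    nlinarith [sq_nonneg δ]
  linarith

lemma eta1N_zero {δ : ℝ} (h : δ ^ 2 < 1) : eta1N δ 0 = eta1 δ := by
  unfold eta1N eta1
  have h1 : 0 < 1 - δ ^ 2 := by linarith
  have h2 : 0 < 2 - δ ^ 2 := by linarith
  congr 2
  rw [zero_pow two_ne_zero, mul_zero, mul_zero, sub_zero, sub_zero, Real.sqrt_mul h1.le,
    Real.sqrt_sq h2.le]
  field_simp

lemma eta1N_lt_eta1 {δ δN : ℝ} (h0 : 0 ≤ δ) (h : δ < √(4 * √5 - 8)) (hN : |δN| ≤ δ ^ 2 / 2)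
    (hN0 : δN ≠ 0) : eta1N δ δN < eta1 δ := by
  obtain ⟨h1, h2⟩ := sq_lt_one_of_lt_sqrt h0 h
  have h3 := eta1N_argument_lt h1 hN hN0
  have h4 := eta1N_bound_numerator h1 hN
  unfold eta1N eta1
  rw [show δ ^ 4 = (δ ^ 2) ^ 2 by ring]
  exact Real.strictAntiOn_arccos ⟨by linarith, by linarith⟩ ⟨by linarith, by linarith⟩
    (by linarith)

end RealInequalities

/-! ### The Taylor expansion of `eta1` -/

section Expansion

lemma abs_cos_sub_taylor_le {x : ℝ} (hx : |x| ≤ 1) :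
    |Real.cos x - (1 - x ^ 2 / 2 + x ^ 4 / 24 - x ^ 6 / 720 + x ^ 8 / 40320)| ≤ |x| ^ 10 := by
  have h := Complex.exp_bound (x := x * Complex.I) (by simpa using hx) (n := 10) (by norm_num)
  have hre : (Complex.exp (x * Complex.I) -
      ∑ m ∈ Finset.range 10, (x * Complex.I) ^ m / (m.factorial : ℂ)).re =
      Real.cos x - (1 - x ^ 2 / 2 + x ^ 4 / 24 - x ^ 6 / 720 + x ^ 8 / 40320) := by
    have hsum : ∑ m ∈ Finset.range 10, (x * Complex.I) ^ m / (m.factorial : ℂ) =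
        ((1 - x ^ 2 / 2 + x ^ 4 / 24 - x ^ 6 / 720 + x ^ 8 / 40320 : ℝ) : ℂ) +
        ((x - x ^ 3 / 6 + x ^ 5 / 120 - x ^ 7 / 5040 + x ^ 9 / 362880 : ℝ) : ℂ) * Complex.I := by
      have h2 := Complex.I_sq
      have h3 := Complex.I_pow_three
      have h4 := Complex.I_pow_four
      have h5 : Complex.I ^ 5 = Complex.I := by rw [pow_succ, h4, one_mul]
      have h6 : Complex.I ^ 6 = -1 := by rw [pow_succ, h5, Complex.I_mul_I]
      have h7 : Complex.I ^ 7 = -Complex.I := by rw [pow_succ, h6, neg_one_mul]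
      have h8 : Complex.I ^ 8 = 1 := by rw [pow_succ, h7, neg_mul, Complex.I_mul_I, neg_neg]
      have h9 : Complex.I ^ 9 = Complex.I := by rw [pow_succ, h8, one_mul]
      simp only [Finset.sum_range_succ, Finset.sum_range_zero, mul_pow, h2, h3, h4, h5, h6, h7, h8,
        h9, Nat.factorial]
      push_cast
      ring
    rw [hsum, Complex.sub_re, Complex.add_re, Complex.ofReal_re, Complex.re_ofReal_mul,
      Complex.I_re, Complex.exp_ofReal_mul_I_re]
    ring
  rw [← hre]
  refine (Complex.abs_re_le_norm _).trans (h.trans ?_)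
  rw [norm_mul, Complex.norm_I, mul_one, Complex.norm_real, Real.norm_eq_abs]
  refine mul_le_of_le_one_right (by positivity) ?_
  norm_num [Nat.factorial]

/-- The Taylor polynomial of `eta1`. -/
noncomputable def eta1Poly (δ : ℝ) : ℝ :=
  δ + 7 / 24 * δ ^ 3 + 123 / 640 * δ ^ 5 + 1083 / 7168 * δ ^ 7

/-- The coefficients of `eta1Poly` are those for which the cosine polynomial matches the truncated
binomial series of `1 - δ² / (2√(1 - δ²))` through degree 8. -/
lemma cos_taylor_eta1Poly : ∃ R : ℝ → ℝ, Continuous R ∧ ∀ δ : ℝ,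
    (1 - eta1Poly δ ^ 2 / 2 + eta1Poly δ ^ 4 / 24 - eta1Poly δ ^ 6 / 720
      + eta1Poly δ ^ 8 / 40320) -
    (1 - δ ^ 2 / 2 * (1 + δ ^ 2 / 2 + 3 / 8 * δ ^ 4 + 5 / 16 * δ ^ 6)) = δ ^ 10 * R δ := by
  -- With `u = δ²`, `eta1Poly δ = δ(1 + u a(u))`. Here `b` and `b'` are the `u²` and `u³`
  -- coefficients of `(1 + u a(u))²`, and `r`, `r₄`, `r₆`, `r₈` are what is left of the powers 2, 4,
  -- 6, 8 after factoring out `δ¹⁰`.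
  let a : ℝ → ℝ := fun u => 7 / 24 + 123 / 640 * u + 1083 / 7168 * u ^ 2
  let r : ℝ → ℝ := fun u => (123 / 640) ^ 2 + 2 * (7 / 24) * (1083 / 7168)
    + 2 * (123 / 640) * (1083 / 7168) * u + (1083 / 7168) ^ 2 * u ^ 2
  let b : ℝ := 2 * (123 / 640) + (7 / 24) ^ 2
  let b' : ℝ := 2 * (1083 / 7168) + 2 * (7 / 24) * (123 / 640)
  let s : ℝ → ℝ := fun u => b + b' * u + r u * u ^ 2
  let r₄ : ℝ → ℝ := fun u => 2 * b' + 7 / 6 * b + (2 * r u + 7 / 6 * b' + b ^ 2) * u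
    + (7 / 6 * r u + 2 * b * b') * u ^ 2 + (2 * b * r u + b' ^ 2) * u ^ 3 + 2 * b' * r u * u ^ 4
    + r u ^ 2 * u ^ 5
  let r₆ : ℝ → ℝ := fun u => 3 * s u + 3 * (7 / 12 + u * s u) ^ 2 + u * (7 / 12 + u * s u) ^ 3
  let r₈ : ℝ → ℝ := fun u => a u * (2 + u * a u) * ((1 + u * a u) ^ 2 + 1) * ((1 + u * a u) ^ 4 + 1)
  have ha : Continuous a := by fun_prop
  have hr : Continuous r := by fun_prop
  have hs : Continuous s := by fun_prop
  have hr₄ : Continuous r₄ := by fun_prop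
  have hr₆ : Continuous r₆ := by fun_prop
  have hr₈ : Continuous r₈ := by fun_prop
  refine ⟨fun δ => -(r (δ ^ 2) / 2) + r₄ (δ ^ 2) / 24 - r₆ (δ ^ 2) / 720 + r₈ (δ ^ 2) / 40320,
    by fun_prop, fun δ => ?_⟩
  have hP : eta1Poly δ = δ * (1 + δ ^ 2 * a (δ ^ 2)) := by
    simp only [eta1Poly, a]; ring
  have hA : (1 + δ ^ 2 * a (δ ^ 2)) ^ 2 =
      1 + 7 / 12 * δ ^ 2 + b * δ ^ 4 + b' * δ ^ 6 + r (δ ^ 2) * δ ^ 8 := by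
    simp only [a, r, b, b']; ring
  have h2 : eta1Poly δ ^ 2 =
      δ ^ 2 * (1 + 7 / 12 * δ ^ 2 + b * δ ^ 4 + b' * δ ^ 6) + δ ^ 10 * r (δ ^ 2) := by
    rw [hP, mul_pow, hA]; ring
  have h4 : eta1Poly δ ^ 4 =
      δ ^ 4 * (1 + 7 / 6 * δ ^ 2 + (2 * b + 49 / 144) * δ ^ 4) + δ ^ 10 * r₄ (δ ^ 2) := by
    rw [show eta1Poly δ ^ 4 = (eta1Poly δ ^ 2) ^ 2 by ring, h2]
    simp only [r₄]; ring
  have h6 : eta1Poly δ ^ 6 = δ ^ 6 * (1 + 7 / 4 * δ ^ 2) + δ ^ 10 * r₆ (δ ^ 2) := by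
    rw [show eta1Poly δ ^ 6 = (eta1Poly δ ^ 2) ^ 3 by ring, h2]
    simp only [r₆, s]; ring
  have h8 : eta1Poly δ ^ 8 = δ ^ 8 + δ ^ 10 * r₈ (δ ^ 2) := by
    rw [hP]
    simp only [r₈]; ring
  rw [h2, h4, h6, h8]
  simp only [b, b']
  ring

lemma isBigO_cos_eta1Poly :
    (fun δ : ℝ => Real.cos (eta1Poly δ) -
      (1 - δ ^ 2 / 2 * (1 + δ ^ 2 / 2 + 3 / 8 * δ ^ 4 + 5 / 16 * δ ^ 6))) =O[𝓝 0]
      (fun δ : ℝ => δ ^ 10) := by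
  have hcont : Continuous eta1Poly := by unfold eta1Poly; fun_prop
  have h0 : eta1Poly 0 = 0 := by simp [eta1Poly]
  have hP : eta1Poly =O[𝓝 0] (fun δ : ℝ => δ) := by
    have : eta1Poly = fun δ : ℝ =>
        δ * (1 + 7 / 24 * δ ^ 2 + 123 / 640 * δ ^ 4 + 1083 / 7168 * δ ^ 6) := by
      ext δ; unfold eta1Poly; ring
    rw [this]
    have hc : Continuous fun δ : ℝ =>
        1 + 7 / 24 * δ ^ 2 + 123 / 640 * δ ^ 4 + 1083 / 7168 * δ ^ 6 := by fun_prop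
    simpa using (isBigO_refl (fun δ : ℝ => δ) (𝓝 0)).mul ((hc.tendsto 0).isBigO_one ℝ)
  have h1 : (fun δ : ℝ => Real.cos (eta1Poly δ) -
      (1 - eta1Poly δ ^ 2 / 2 + eta1Poly δ ^ 4 / 24 - eta1Poly δ ^ 6 / 720
        + eta1Poly δ ^ 8 / 40320)) =O[𝓝 0] (fun δ : ℝ => δ ^ 10) := by
    refine IsBigO.trans (IsBigO.of_bound 1 ?_) (hP.pow 10)
    have : ∀ᶠ δ in 𝓝 (0 : ℝ), |eta1Poly δ| < 1 :=
      hcont.abs.continuousAt.eventually_lt_const (by simp [h0])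
    filter_upwards [this] with δ hδ
    rw [one_mul, norm_pow, Real.norm_eq_abs, Real.norm_eq_abs]
    exact abs_cos_sub_taylor_le hδ.le
  obtain ⟨R, hR, hRδ⟩ := cos_taylor_eta1Poly
  have h2 : (fun δ : ℝ => δ ^ 10 * R δ) =O[𝓝 0] (fun δ : ℝ => δ ^ 10) := by
    simpa using (isBigO_refl (fun δ : ℝ => δ ^ 10) (𝓝 0)).mul
      ((hR.tendsto 0).isBigO_one ℝ)
  refine (h1.add h2).congr_left fun δ => ?_
  rw [← hRδ]; ring

lemma isBigO_inv_sqrt_one_sub_sq :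
    (fun δ : ℝ => δ ^ 2 / (2 * √(1 - δ ^ 2)) -
      δ ^ 2 / 2 * (1 + δ ^ 2 / 2 + 3 / 8 * δ ^ 4 + 5 / 16 * δ ^ 6)) =O[𝓝 0]
      (fun δ : ℝ => δ ^ 10) := by
  let Q : ℝ → ℝ := fun δ => 1 + δ ^ 2 / 2 + 3 / 8 * δ ^ 4 + 5 / 16 * δ ^ 6
  -- Rationalizing with `v = √(1 - δ²)`: `1/v - Q = (1 - v²Q²) / (v(1 + vQ))`, whose numerator is
  -- divisible by `δ⁸`.
  let W : ℝ → ℝ := fun δ => (35 / 64 + 7 / 32 * δ ^ 2 + 35 / 256 * δ ^ 4 + 25 / 256 * δ ^ 6) /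
    (2 * √(1 - δ ^ 2) * (1 + √(1 - δ ^ 2) * Q δ))
  have hW : ContinuousAt W 0 := by
    apply ContinuousAt.div (by fun_prop) (by fun_prop)
    simp [Q]
  have h2 : (fun δ : ℝ => δ ^ 10 * W δ) =O[𝓝 0] (fun δ : ℝ => δ ^ 10) := by
    simpa using (isBigO_refl (fun δ : ℝ => δ ^ 10) (𝓝 0)).mul (hW.isBigO_one ℝ)
  refine h2.congr' ?_ EventuallyEq.rfl
  have : ∀ᶠ δ in 𝓝 (0 : ℝ), δ ^ 2 < 1 :=
    (by fun_prop : Continuous fun δ : ℝ => δ ^ 2).continuousAt.eventually_lt_const (by simp)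
  filter_upwards [this] with δ hδ
  have h1 : 0 < 1 - δ ^ 2 := by linarith
  have hs : 0 < √(1 - δ ^ 2) := Real.sqrt_pos.2 h1
  have hs2 : √(1 - δ ^ 2) ^ 2 = 1 - δ ^ 2 := Real.sq_sqrt h1.le
  have hQ : 0 < Q δ := by simp only [Q]; positivity
  change δ ^ 10 * W δ = δ ^ 2 / (2 * √(1 - δ ^ 2)) - δ ^ 2 / 2 * Q δ
  have hQ2 : 1 - (1 - δ ^ 2) * Q δ ^ 2 =
      δ ^ 8 * (35 / 64 + 7 / 32 * δ ^ 2 + 35 / 256 * δ ^ 4 + 25 / 256 * δ ^ 6) := by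
    simp only [Q]; ring
  simp only [W]
  set v := √(1 - δ ^ 2)
  rw [div_sub' (by positivity), mul_div_assoc', div_eq_div_iff (by positivity) (by positivity)]
  rw [← hs2] at hQ2
  linear_combination (-2 * v * δ ^ 2) * hQ2

/-- The difference of the cosines is a product of sines of half-sum and half-difference. The
half-sum is at least of order `δ`, so dividing by its sine costs one power of `δ`. -/
lemma isBigO_eta1_sub :
    (fun δ : ℝ => eta1 δ - eta1Poly δ) =O[𝓝[>] 0] (fun δ : ℝ => δ ^ 9) := by
  have hc : (fun δ : ℝ => Real.cos (eta1Poly δ) - (1 - δ ^ 2 / (2 * √(1 - δ ^ 2)))) =O[𝓝 0]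
      (fun δ : ℝ => δ ^ 10) :=
    (isBigO_cos_eta1Poly.add isBigO_inv_sqrt_one_sub_sq).congr_left fun δ => by ring
  obtain ⟨C, hC, hbound⟩ := hc.exists_pos
  have hy : ContinuousAt (fun δ : ℝ => δ ^ 2 / (2 * √(1 - δ ^ 2))) 0 :=
    ContinuousAt.div (by fun_prop) (by fun_prop) (by simp)
  have hη : ContinuousAt eta1 0 :=
    Real.continuous_arccos.continuousAt.comp (continuousAt_const.sub hy)
  have hcont : Continuous eta1Poly := by unfold eta1Poly; fun_prop
  have e1 : ∀ᶠ δ in 𝓝 (0 : ℝ), δ ^ 2 / (2 * √(1 - δ ^ 2)) < 1 :=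
    hy.eventually_lt_const (by simp)
  have e2 : ∀ᶠ δ in 𝓝 (0 : ℝ), eta1 δ < 1 := hη.eventually_lt_const (by simp [eta1])
  have e3 : ∀ᶠ δ in 𝓝 (0 : ℝ), eta1Poly δ < 1 :=
    hcont.continuousAt.eventually_lt_const (by simp [eta1Poly])
  -- The sines are at least `δ / 4` and a quarter of the error, and the product formula has a factor
  -- 2: `2 · (1/4) · (1/4) = 1/8`.
  refine IsBigO.of_bound (8 * C) ?_
  filter_upwards [nhdsWithin_le_nhds hbound.bound, nhdsWithin_le_nhds e1, nhdsWithin_le_nhds e2,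
    nhdsWithin_le_nhds e3, self_mem_nhdsWithin] with δ h1 h2 h3 h4 (hδ : 0 < δ)
  have hy0 : 0 ≤ δ ^ 2 / (2 * √(1 - δ ^ 2)) := by positivity
  have hcos : Real.cos (eta1 δ) = 1 - δ ^ 2 / (2 * √(1 - δ ^ 2)) :=
    Real.cos_arccos (by linarith) (by linarith)
  have hη0 : 0 ≤ eta1 δ := Real.arccos_nonneg _
  have hPδ : δ ≤ eta1Poly δ := by
    have : 0 ≤ 7 / 24 * δ ^ 3 + 123 / 640 * δ ^ 5 + 1083 / 7168 * δ ^ 7 := by positivity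
    unfold eta1Poly; linarith
  rw [← hcos, Real.cos_sub_cos, Real.norm_eq_abs, Real.norm_eq_abs, abs_mul, abs_mul,
    abs_of_pos (pow_pos hδ 10)] at h1
  rw [Real.norm_eq_abs, Real.norm_eq_abs, abs_of_pos (pow_pos hδ 9)]
  have hπ : 1 / 2 ≤ 2 / Real.pi := by
    rw [div_le_div_iff₀ (by norm_num) Real.pi_pos]; linarith [Real.pi_lt_four]
  have hsin : ∀ x : ℝ, |x| ≤ 1 → |x| / 2 ≤ |Real.sin x| := fun x hx => by
    have h := Real.mul_abs_le_abs_sin (x := x) (by linarith [Real.pi_gt_three])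
    nlinarith [abs_nonneg x]
  have hs1 := hsin ((eta1Poly δ + eta1 δ) / 2) (by rw [abs_le]; constructor <;> linarith)
  have hs2 := hsin ((eta1Poly δ - eta1 δ) / 2) (by rw [abs_le]; constructor <;> linarith)
  rw [abs_of_nonneg (by linarith : 0 ≤ (eta1Poly δ + eta1 δ) / 2)] at hs1
  rw [abs_div, abs_two, abs_sub_comm] at hs2
  have hs3 : δ / 4 ≤ |Real.sin ((eta1Poly δ + eta1 δ) / 2)| := by linarith
  have h5 : δ / 4 * (|eta1 δ - eta1Poly δ| / 2 / 2) ≤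
      |Real.sin ((eta1Poly δ + eta1 δ) / 2)| * |Real.sin ((eta1Poly δ - eta1 δ) / 2)| := by
    gcongr
  rw [abs_neg, abs_two] at h1
  have h6 : |eta1 δ - eta1Poly δ| * δ ≤ (8 * C * δ ^ 9) * δ := by nlinarith
  exact le_of_mul_le_mul_right h6 hδ

end Expansion

/-! ### The geometric inequality and the angle bounds -/

section NormalVariation

variable {d : ℕ} {S : Set (EuclideanSpace ℝ (Fin d))} {p q e n : EuclideanSpace ℝ (Fin d)}

/-- `infDist` to an empty set is `0`, so the medial axis must be shown nonempty as well as away from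
`p`; the outward normal supplies the bounded complementary component for this. -/
lemma IsClosedHypersurface.lfs_pos (hS : IsClosedHypersurface S) (hp : p ∈ S) (he : ‖e‖ = 1)
    (h : IsOutwardNormal S p e) : 0 < lfs S p :=
  (isClosed_closure.notMem_iff_infDist_pos (hS.medialAxis_nonempty hp he h)).1
    (hS.notMem_medialAxis hp)

/-- A line through a point `q` of the ball of radius `L` about `p` leaves the ball. -/
lemma exists_dist_add_smul_eq {L : ℝ} (hn : ‖n‖ = 1) (hpq : dist q p < L) :
    ∃ t, 0 < t ∧ t ^ 2 + 2 * t * inner ℝ (q - p) n = L ^ 2 - dist q p ^ 2 ∧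
      dist (q + t • n) p = L := by
  set b : ℝ := inner ℝ (q - p) n
  have hL : 0 < L := dist_nonneg.trans_lt hpq
  have h1 : 0 < L ^ 2 - dist q p ^ 2 := by
    have := dist_nonneg (x := q) (y := p)
    nlinarith
  set w := √(b ^ 2 + (L ^ 2 - dist q p ^ 2)) with hw
  have hw2 : w ^ 2 = b ^ 2 + (L ^ 2 - dist q p ^ 2) := Real.sq_sqrt (by positivity)
  have hbw : b < w := Real.lt_sqrt_of_sq_lt (by linarith)
  have ht : (w - b) ^ 2 + 2 * (w - b) * b = L ^ 2 - dist q p ^ 2 := by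
    linear_combination hw2
  refine ⟨w - b, by linarith, ht, ?_⟩
  have h2 : dist (q + (w - b) • n) p ^ 2 = L ^ 2 := by
    rw [dist_eq_norm, show q + (w - b) • n - p = (q - p) + (w - b) • n by abel, norm_add_sq_real,
      norm_smul, hn, real_inner_smul_right, mul_one, Real.norm_eq_abs, sq_abs, ← dist_eq_norm]
    linear_combination ht
  exact (pow_left_inj₀ dist_nonneg hL.le two_ne_zero).1 h2

/-- The normal component of `q - p` is bounded quadratically, since `q` lies outside of the empty
balls that touch `S` at `p`. -/
lemma IsClosedHypersurface.abs_inner_le (hS : IsClosedHypersurface S) (hp : p ∈ S) (hq : q ∈ S)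
    (he : ‖e‖ = 1) (hep : IsNormalAt S p e) (hL : 0 < lfs S p) :
    |inner ℝ e (q - p)| ≤ dist q p ^ 2 / (2 * lfs S p) := by
  have key : ∀ e : EuclideanSpace ℝ (Fin d), ‖e‖ = 1 → IsNormalAt S p e →
      inner ℝ e (q - p) ≤ dist q p ^ 2 / (2 * lfs S p) := by
    intro e he hep
    have h1 : infDist (p + lfs S p • e) S = lfs S p :=
      hS.infDist_add_smul (p := p) hp he hep (by rwa [dist_self]) hL
      (by rw [dist_self_add_left, norm_smul, he, mul_one, Real.norm_of_nonneg hL.le])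
    have h2 : lfs S p ≤ dist (p + lfs S p • e) q :=
      h1.symm.trans_le (infDist_le_dist_of_mem hq)
    have h3 : dist (p + lfs S p • e) q ^ 2 =
        dist q p ^ 2 - 2 * lfs S p * inner ℝ e (q - p) + lfs S p ^ 2 := by
      generalize lfs S p = L
      rw [dist_comm, dist_eq_norm, show q - (p + L • e) = (q - p) - L • e by abel,
        norm_sub_sq_real, norm_smul, he, real_inner_smul_right, mul_one, Real.norm_eq_abs, sq_abs,
        ← dist_eq_norm, real_inner_comm]
      ring
    rw [le_div_iff₀ (by positivity)]
    nlinarith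
  refine abs_le.2 ⟨?_, key e he hep⟩
  have := key (-e) (by rwa [norm_neg]) hep.neg
  rw [inner_neg_left] at this
  linarith

/-- The ball on the outer side of `S` at `q` and the ball on the inner side at `p` are disjoint. -/
lemma IsClosedHypersurface.sq_le_of_outside_inside (hS : IsClosedHypersurface S) (hp : p ∈ S)
    (hq : q ∈ S) (he : ‖e‖ = 1) (hn : ‖n‖ = 1) (hep : IsNormalAt S p e) (hnq : IsNormalAt S q n)
    (hpq : dist q p < lfs S p) {t : ℝ} (ht : 0 < t) (htL : dist (q + t • n) p = lfs S p)
    (hdisj : infDist (q + t • n) S = t → infDist (p + lfs S p • -e) S = lfs S p →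
      Disjoint (ball (q + t • n) t) (ball (p + lfs S p • -e) (lfs S p))) :
    (t + lfs S p) ^ 2 ≤
      2 * lfs S p ^ 2 + 2 * lfs S p * (inner ℝ e (q - p) + t * inner ℝ e n) := by
  have hL : 0 < lfs S p := dist_nonneg.trans_lt hpq
  have h1 := hS.infDist_add_smul hq hn hnq hpq ht htL.le
  have h2 := hS.infDist_add_smul hp (n := -e) (by rwa [norm_neg]) hep.neg (p := p)
    (by rwa [dist_self]) hL
    (by rw [dist_self_add_left, norm_smul, norm_neg, he, mul_one, Real.norm_of_nonneg hL.le])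
  have h3 := add_le_dist_of_disjoint_ball ht hL (hdisj h1 h2)
  have h4 : dist (q + t • n) (p + lfs S p • -e) ^ 2 =
      2 * lfs S p ^ 2 + 2 * lfs S p * (inner ℝ e (q - p) + t * inner ℝ e n) := by
    rw [dist_eq_norm, show q + t • n - (p + lfs S p • -e) = (q + t • n - p) + lfs S p • e by
      rw [smul_neg]; abel, norm_add_sq_real, ← dist_eq_norm, htL, norm_smul, he, mul_one,
      real_inner_smul_right, Real.norm_eq_abs, sq_abs, real_inner_comm,
      show q + t • n - p = (q - p) + t • n by abel, inner_add_right, real_inner_smul_right]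
    ring
  rw [← h4]
  gcongr

/-- The normal variation bound for unit normals, in terms of the cosine of the angle. -/
lemma IsClosedHypersurface.one_sub_div_sqrt_le_inner (hS : IsClosedHypersurface S) (hp : p ∈ S)
    (hq : q ∈ S) (he : ‖e‖ = 1) (hn : ‖n‖ = 1) (hpe : IsOutwardNormal S p e)
    (hqn : IsOutwardNormal S q n) (hδ : relDist S p q < 1) :
    |inner ℝ e (q - p) / lfs S p| ≤ relDist S p q ^ 2 / 2 ∧
    1 - (relDist S p q ^ 2 - (relDist S p q ^ 2) ^ 2 / 2 -
        2 * (inner ℝ e (q - p) / lfs S p) ^ 2) /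
      √((1 - relDist S p q ^ 2) * ((2 - relDist S p q ^ 2) ^ 2 -
        4 * (inner ℝ e (q - p) / lfs S p) ^ 2)) ≤ inner ℝ e n := by
  have hL := hS.lfs_pos hp he hpe
  have hpq : dist q p < lfs S p := by
    rw [relDist, div_lt_one hL] at hδ
    rwa [dist_comm]
  have hC := hS.connectedComponentIn_eq hp hq hpq
  -- The two ends of the chord cut from the normal line at `q` by the sphere of radius `lfs S p`
  -- about `p`.
  obtain ⟨t, ht, hteq, htL⟩ := exists_dist_add_smul_eq hn hpq
  obtain ⟨t', ht', hteq', htL'⟩ := exists_dist_add_smul_eq (n := -n) (by rwa [norm_neg]) hpq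
  have h1 := hS.sq_le_of_outside_inside hp hq he hn hpe.isNormalAt hqn.isNormalAt hpq ht htL
    fun hb hb' => disjoint_outside_inside.mono (hqn.ball_subset_outside hn ht hb)
      (hC ▸ hpe.ball_subset_inside he hL hb')
  have h2 := hS.sq_le_of_outside_inside (e := -e) (n := -n) hp hq (by rwa [norm_neg])
    (by rwa [norm_neg]) hpe.isNormalAt.neg hqn.isNormalAt.neg hpq ht' htL'
    fun hb hb' => disjoint_outside_inside.symm.mono (hqn.ball_subset_inside hn ht' hb)
      (by
        rw [neg_neg] at hb' ⊢
        exact hC ▸ hpe.ball_subset_outside he hL hb')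
  have ha := hS.abs_inner_le hp hq he hpe.isNormalAt hL
  have hδ' : dist q p = relDist S p q * lfs S p := by
    rw [relDist, div_mul_cancel₀ _ hL.ne', dist_comm]
  have hδ0 : 0 ≤ relDist S p q := div_nonneg dist_nonneg hL.le
  set L := lfs S p
  set δ := relDist S p q
  set a : ℝ := inner ℝ e (q - p)
  set c : ℝ := inner ℝ e n
  set b : ℝ := inner ℝ (q - p) n
  rw [inner_neg_right] at hteq'
  rw [inner_neg_neg, inner_neg_left] at h2
  rw [hδ'] at hteq hteq' ha
  have hD : δ ^ 2 < 1 := by nlinarith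
  have ha' : |a / L| ≤ δ ^ 2 / 2 := by
    rw [abs_div, abs_of_pos hL, div_le_iff₀ hL]
    refine ha.trans_eq ?_
    field_simp
  refine ⟨ha', one_sub_div_sqrt_le (s := t / L) (s' := t' / L) hD ha' (by positivity) ?_ ?_ ?_⟩
  -- Power of the point `q`: combining the two chord equations eliminates `b` and leaves `t * t' =
  -- L² - |pq|²`.
  · have hsum : (t + t') * (t * t') = (t + t') * (L ^ 2 * (1 - δ ^ 2)) := by
      linear_combination t' * hteq + t * hteq'
    have := mul_left_cancel₀ (by positivity) hsum
    rw [div_mul_div_comm, this]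
    field_simp
  · have : ((t + L) ^ 2) / L ^ 2 ≤ (2 * L ^ 2 + 2 * L * (a + t * c)) / L ^ 2 := by gcongr
    convert this using 1 <;> field_simp <;> ring
  · have : ((t' + L) ^ 2) / L ^ 2 ≤ (2 * L ^ 2 + 2 * L * (-a + t' * c)) / L ^ 2 := by gcongr
    convert this using 1 <;> field_simp <;> ring

lemma IsClosedHypersurface.angle_le (hS : IsClosedHypersurface S) (hp : p ∈ S) (hq : q ∈ S)
    (hpe : IsOutwardNormal S p e) (hqn : IsOutwardNormal S q n)
    (hδ : relDist S p q < √(4 * √5 - 8)) :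
    InnerProductGeometry.angle e n ≤ eta1 (relDist S p q) ∧
    InnerProductGeometry.angle e n ≤ eta1N (relDist S p q) (relNormalDist S p q) ∧
    (relNormalDist S p q ≠ 0 →
      eta1N (relDist S p q) (relNormalDist S p q) < eta1 (relDist S p q)) := by
  have he0 := norm_pos_iff.2 hpe.ne_zero
  have hn0 := norm_pos_iff.2 hqn.ne_zero
  set e' := ‖e‖⁻¹ • e with he'
  set n' := ‖n‖⁻¹ • n with hn'
  have he1 : ‖e'‖ = 1 := norm_smul_inv_norm (𝕜 := ℝ) hpe.ne_zero
  have hn1 : ‖n'‖ = 1 := norm_smul_inv_norm (𝕜 := ℝ) hqn.ne_zero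
  have hpe' : IsOutwardNormal S p e' := hpe.smul (inv_pos.2 he0)
  have hqn' : IsOutwardNormal S q n' := hqn.smul (inv_pos.2 hn0)
  have hangle : InnerProductGeometry.angle e n = Real.arccos (inner ℝ e' n') := by
    rw [← InnerProductGeometry.angle_smul_left_of_pos e n (inv_pos.2 he0),
      ← InnerProductGeometry.angle_smul_right_of_pos _ n (inv_pos.2 hn0),
      InnerProductGeometry.angle, ← he', ← hn', he1, hn1, mul_one, div_one]
  have hL := hS.lfs_pos hp he1 hpe'
  have hδ0 : 0 ≤ relDist S p q := div_nonneg dist_nonneg hL.le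
  have hδ1 := (sq_lt_one_of_lt_sqrt hδ0 hδ).1
  obtain ⟨ha, hbound⟩ := hS.one_sub_div_sqrt_le_inner hp hq he1 hn1 hpe' hqn' (by nlinarith)
  have hN : relNormalDist S p q = |inner ℝ e' (q - p) / lfs S p| := by
    rw [relNormalDist, infDist_tangentFlat he1
      (hS.tangentConeAt_eq hp hpe'.ne_zero hpe'.isNormalAt), abs_div, abs_of_pos hL]
  have h2 : InnerProductGeometry.angle e n ≤ eta1N (relDist S p q) (relNormalDist S p q) := by
    rw [hangle, eta1N, hN, sq_abs, show relDist S p q ^ 4 = (relDist S p q ^ 2) ^ 2 by ring]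
    exact Real.arccos_le_arccos hbound
  have h3 : relNormalDist S p q ≠ 0 →
      eta1N (relDist S p q) (relNormalDist S p q) < eta1 (relDist S p q) :=
    eta1N_lt_eta1 hδ0 hδ (by rwa [hN, abs_abs])
  refine ⟨?_, h2, h3⟩
  -- The first bound follows from the second: they coincide when the normal component vanishes, and
  -- otherwise the second is smaller.
  by_cases h0 : relNormalDist S p q = 0
  · rwa [h0, eta1N_zero hδ1] at h2
  · exact h2.trans (h3 h0).le

end NormalVariation

theorem lemma5 :
    (∀ (d : ℕ) (S : Set (EuclideanSpace ℝ (Fin d))), IsClosedHypersurface S →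
      ∀ p ∈ S, ∀ q ∈ S, ∀ n_p n_q : EuclideanSpace ℝ (Fin d),
        IsOutwardNormal S p n_p → IsOutwardNormal S q n_q →
        relDist S p q < √(4 * √5 - 8) →
          InnerProductGeometry.angle n_p n_q ≤ eta1 (relDist S p q) ∧
          InnerProductGeometry.angle n_p n_q ≤ eta1N (relDist S p q) (relNormalDist S p q) ∧
          (relNormalDist S p q ≠ 0 →
            eta1N (relDist S p q) (relNormalDist S p q) < eta1 (relDist S p q))) ∧
    (fun δ : ℝ => eta1 δ -
        (δ + 7 / 24 * δ ^ 3 + 123 / 640 * δ ^ 5 + 1083 / 7168 * δ ^ 7))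
      =O[𝓝[>] 0] (fun δ : ℝ => δ ^ 9) := by
  exact ⟨fun _ _ hS _ hp _ hq _ _ hpe hqn hδ => hS.angle_le hp hq hpe hqn hδ, isBigO_eta1_sub⟩
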